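/- Let $I\subseteq\mathbb R$ be a nonempty open interval and let $c,p,s\in C^\infty(I)$ with $c(u)\neq0$ for all $u\in I$. Work with local functionals $\int h\,dx$, where $h$ is a differential polynomial (a polynomial in $u_x,u_{xx},\dots$ with coefficients in $C^\infty(I)$), taken modulo total $x$-derivatives, and with everything taken modulo $O(\epsilon^6)$. The grading is $\deg u^{(n)}=n$ for $n\ge1$, and functions of $u$ have degree $0$. For $f\in C^\infty(I)$ put $H_f=\int h_f\,dx$, $$h_f=f-\frac{\epsilon^2}{24}\,c\,f'''u_x^2+\epsilon^4\Big[\Big(p f'''+\frac{c^2f^{(4)}}{480}\Big)u_{xx}^2-\Big(\frac{c\,c''f^{(4)}}{1152}+\frac{c\,c'f^{(5)}}{1152}+\frac{c^2f^{(6)}}{3456}+\frac{p'f^{(4)}}6+\frac{p f^{(5)}}6-s f'''\Big)u_x^4\Big].$$ Let $q\in C^\infty(I)$ with $q'(u)\ne 0$ for all $u\in I$. A *bihamiltonian structure of the family $(H_f)$ deforming the pencil* $\{u(x),u(y)\}_1=\delta'(x-y)$, $\{u(x),u(y)\}^{[0]}_2=q(u)\delta'(x-y)+\frac12q'(u)u_x\delta(x-y)$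 is a bracket $$\{u(x),u(y)\}_2=\{u(x),u(y)\}_2^{[0]}+\sum_{n=1}^{5}\epsilon^n\sum_{j=0}^{n+1}A_{n,j}(u;u_x,\dots)\,\delta^{(j)}(x-y)+O(\epsilon^6),$$ with $A_{n,j}$ a homogeneous differential polynomial of degree $n+1-j$, such that, modulo $O(\epsilon^6)$, $\{\,,\}_1$ and all $\{\,,\}_2-\lambda\{\,,\}_1$ ($\lambda\in\mathbb R$) are Poisson brackets (antisymmetric and satisfying the Jacobi identity on local functionals), and $\{H_f,H_g\}_1=\{H_f,H_g\}_2=O(\epsilon^6)$ for all $f,g\in C^\infty(I)$. Then: 1. For given $q$ such a structure exists if and only if $$p=\frac{c^2}{960}\Big[5\,\frac{c'}{c}-\frac{q''}{q'}\Big]\quad\text{on } I,$$ and in that case it is unique (modulo $O(\epsilon^6)$). This holds for every $s$, in particular in the normalization $s=0$. 2. For every $c,p,s$ as above there is a $q$ with nowhere vanishing $q'$ for which such a structure exists. The resulting pencil is unique: if $\{\,,\}_2$ and $\widetilde{\{\,,\}}_2$ are such structures for $q$ and $\tilde q$, then there are real constants $a\ne0$ and $b$ with $\tilde q=a q+b$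 and $\widetilde{\{\,,\}}_2=a\{\,,\}_2+b\{\,,\}_1$. 3. For such a structure, all flows are Hamiltonian with respect to both brackets: if $f''=q\,g''+\frac12q'g'$, then $\{u(x),H_f\}_1=\{u(x),H_g\}_2$ modulo $O(\epsilon^6)$. -/

import Mathlib

open TopologicalSpace
open scoped ContDiff

namespace BiHam

noncomputable section

/-- The smooth real functions on an open set `I ⊆ ℝ`, as a subalgebra of all functions. -/
def smoothSubalgebra (I : Opens ℝ) : Subalgebra ℝ (I → ℝ) where
  carrier := {f | ∃ g : ℝ → ℝ, ContDiffOn ℝ ∞ g I ∧ ∀ u : I, f u = g u}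
  mul_mem' := by
    rintro _ _ ⟨g, hg, hfg⟩ ⟨k, hk, hfk⟩
    exact ⟨fun x => g x * k x, hg.mul hk, fun u => by simp [hfg u, hfk u]⟩
  add_mem' := by
    rintro _ _ ⟨g, hg, hfg⟩ ⟨k, hk, hfk⟩
    exact ⟨fun x => g x + k x, hg.add hk, fun u => by simp [hfg u, hfk u]⟩
  algebraMap_mem' r := ⟨fun _ => r, contDiffOn_const, fun _ => rfl⟩

/-- The algebra `C^∞(I)`. -/
def Smooth (I : Opens ℝ) : Type := smoothSubalgebra I

instance (I : Opens ℝ) : CommRing (Smooth I) := inferInstanceAs (CommRing (smoothSubalgebra I))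

instance (I : Opens ℝ) : Algebra ℝ (Smooth I) := inferInstanceAs (Algebra ℝ (smoothSubalgebra I))

instance (I : Opens ℝ) : CoeFun (Smooth I) (fun _ => I → ℝ) := ⟨Subtype.val⟩

/-- The derivative `f ↦ f'` of smooth functions on `I`. -/
def der {I : Opens ℝ} (f : Smooth I) : Smooth I :=
  ⟨fun u => deriv (Function.extend Subtype.val (f : I → ℝ) 0) u, by
    obtain ⟨f, g, hg, hfg⟩ := f
    refine ⟨deriv g, ((contDiffOn_infty_iff_deriv_of_isOpen I.isOpen).1 hg).2, fun u => ?_⟩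
    apply Filter.EventuallyEq.deriv_eq
    filter_upwards [I.isOpen.mem_nhds u.2] with x hx
    exact (Subtype.val_injective.extend_apply f 0 ⟨x, hx⟩).trans (hfg ⟨x, hx⟩)⟩

/-- Differential polynomials in one field `u`: polynomials in `u_x, u_xx, …` whose coefficients
are smooth functions of `u ∈ I`.  The variable `X n` stands for the derivative `u^{(n+1)}`. -/
abbrev DiffPoly (I : Opens ℝ) : Type := MvPolynomial ℕ (Smooth I)

/-- A function of `u`, viewed as a differential polynomial. -/
def fn {I : Opens ℝ} (f : Smooth I) : DiffPoly I := MvPolynomial.C f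

/-- The jet variable `u^{(n+1)}`; thus `jet 0 = u_x` and `jet 1 = u_xx`. -/
def jet {I : Opens ℝ} (n : ℕ) : DiffPoly I := MvPolynomial.X n

/-- `∂F/∂u`: the coefficients of `F` are differentiated. -/
def partialU {I : Opens ℝ} (F : DiffPoly I) : DiffPoly I :=
  ∑ m ∈ F.support, MvPolynomial.monomial m (der (F.coeff m))

/-- The total `x`-derivative
`∂_x F = u_x ∂F/∂u + ∑_{n ≥ 1} u^{(n+1)} ∂F/∂u^{(n)}`. -/
def totalD {I : Opens ℝ} (F : DiffPoly I) : DiffPoly I :=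
  jet 0 * partialU F + ∑ n ∈ F.vars, jet (n + 1) * MvPolynomial.pderiv n F

/-- The variational derivative (Euler–Lagrange operator)
`δ/δu(x) ∫ F dx = ∂F/∂u + ∑_{n ≥ 1} (-∂_x)^n ∂F/∂u^{(n)}`. -/
def varD {I : Opens ℝ} (F : DiffPoly I) : DiffPoly I :=
  partialU F + ∑ n ∈ F.vars, (-1) ^ (n + 1) * totalD^[n + 1] (MvPolynomial.pderiv n F)

/-- `F` has degree `d` for the grading `deg u^{(n)} = n` (`n ≥ 1`), functions of `u` having
degree `0`. -/
def HasDegree {I : Opens ℝ} (F : DiffPoly I) (d : ℕ) : Prop :=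
  MvPolynomial.IsWeightedHomogeneous (fun n : ℕ => n + 1) F d

/-- Differential operators `∑_j A_j ∂_x^j`, given by their coefficients.  The operator with
coefficients `A_j` encodes the local bivector `{u(x), u(y)} = ∑_j A_j(u; u_x, …) δ^{(j)}(x - y)`. -/
abbrev DiffOp (I : Opens ℝ) : Type := ℕ →₀ DiffPoly I

/-- The action of a differential operator. -/
def DiffOp.act {I : Opens ℝ} (A : DiffOp I) (F : DiffPoly I) : DiffPoly I :=
  A.sum fun j a => a * totalD^[j] F

/-- Series `∑_{n ≤ 5} ε^n a_n` modulo `O(ε^6)`. -/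
abbrev Ser (R : Type) : Type := Fin 6 → R

/-- The product of series modulo `O(ε^6)`, for a given product of coefficients. -/
def Ser.conv {R S T : Type} [AddCommMonoid T] (m : R → S → T) (a : Ser R) (b : Ser S) : Ser T :=
  fun n => ∑ i : Fin 6, ∑ j : Fin 6, if (i : ℕ) + (j : ℕ) = (n : ℕ) then m (a i) (b j) else 0

/-- The local functional `∫ F dx` vanishes modulo `O(ε^6)`: the density is a total derivative. -/
def IsNull {I : Opens ℝ} (F : Ser (DiffPoly I)) : Prop :=
  ∀ n, ∃ Q : DiffPoly I, F n = totalD Q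

/-- `{u(x), ∫ G dx} = L (δG/δu)` modulo `O(ε^6)`. -/
def field {I : Opens ℝ} (L : Ser (DiffOp I)) (G : Ser (DiffPoly I)) : Ser (DiffPoly I) :=
  Ser.conv DiffOp.act L (fun j => varD (G j))

/-- A density of the bracket `{∫ F dx, ∫ G dx} = ∫ (δF/δu) L (δG/δu) dx` modulo `O(ε^6)`. -/
def bracket {I : Opens ℝ} (L : Ser (DiffOp I)) (F G : Ser (DiffPoly I)) : Ser (DiffPoly I) :=
  Ser.conv (fun a b => a * b) (fun i => varD (F i)) (field L G)

/-- `L` defines a Poisson bracket modulo `O(ε^6)`: the bracket of local functionals is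
antisymmetric and satisfies the Jacobi identity. -/
structure IsPoisson {I : Opens ℝ} (L : Ser (DiffOp I)) : Prop where
  antisymm : ∀ F G, IsNull (bracket L F G + bracket L G F)
  jacobi : ∀ F G H, IsNull (bracket L (bracket L F G) H + bracket L (bracket L G H) F
    + bracket L (bracket L H F) G)

/-- The first bracket `{u(x), u(y)}_1 = δ'(x - y)`. -/
def firstOp (I : Opens ℝ) : Ser (DiffOp I) :=
  fun n => if n = 0 then Finsupp.single 1 1 else 0

/-- The undeformed second bracket `q(u) δ'(x - y) + ½ q'(u) u_x δ(x - y)`. -/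
def secondOp {I : Opens ℝ} (q : Smooth I) : DiffOp I :=
  Finsupp.single 1 (fn q) + Finsupp.single 0 (fn ((1 / 2 : ℝ) • der q) * jet 0)

/-- `L` is a deformation of `A`: `L = A + ∑_{n ≥ 1} ε^n L_n` where the coefficient of
`δ^{(j)}(x - y)` in `L_n` is a differential polynomial of degree `n + 1 - j`, and is zero
when `j > n + 1`. -/
structure IsDeformation {I : Opens ℝ} (A : DiffOp I) (L : Ser (DiffOp I)) : Prop where
  leading : L 0 = A
  graded : ∀ (n : Fin 6) (j : ℕ), L n j ≠ 0 → ∃ d : ℕ, d + j = (n : ℕ) + 1 ∧ HasDegree (L n j) d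

/-- The Hamiltonian density `h_f` with functional parameters `c, p, s`:
`f - ε²/24 c f''' u_x² + ε⁴ [(p f''' + c² f⁽⁴⁾/480) u_xx² - (c c'' f⁽⁴⁾/1152 + c c' f⁽⁵⁾/1152
  + c² f⁽⁶⁾/3456 + p' f⁽⁴⁾/6 + p f⁽⁵⁾/6 - s f''') u_x⁴]`. -/
def ham {I : Opens ℝ} (c p s f : Smooth I) : Ser (DiffPoly I) :=
  ![fn f,
    0,
    -fn ((1 / 24 : ℝ) • (c * der^[3] f)) * jet 0 ^ 2,
    0,
    fn (p * der^[3] f + (1 / 480 : ℝ) • (c ^ 2 * der^[4] f)) * jet 1 ^ 2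
      - fn ((1 / 1152 : ℝ) • (c * der^[2] c * der^[4] f)
          + (1 / 1152 : ℝ) • (c * der c * der^[5] f)
          + (1 / 3456 : ℝ) • (c ^ 2 * der^[6] f)
          + (1 / 6 : ℝ) • (der p * der^[4] f)
          + (1 / 6 : ℝ) • (p * der^[5] f)
          - s * der^[3] f) * jet 0 ^ 4,
    0]

/-- `L` is, modulo `O(ε^6)`, the second bracket of a bihamiltonian structure of the Hamiltonians
`H_f`, deforming the pencil `δ'`, `q δ' + ½ q' u_x δ`, with first bracket `δ'`:
`{ , }_2 - λ { , }_1` is a Poisson bracket for all `λ`, and the `H_f` commute pairwise with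
respect to both brackets. -/
structure IsBihamiltonian {I : Opens ℝ} (c p s q : Smooth I) (L : Ser (DiffOp I)) : Prop where
  deformation : IsDeformation (secondOp q) L
  first : IsPoisson (firstOp I)
  pencil : ∀ l : ℝ, IsPoisson (L - l • firstOp I)
  commute_first : ∀ f g, IsNull (bracket (firstOp I) (ham c p s f) (ham c p s g))
  commute_second : ∀ f g, IsNull (bracket L (ham c p s f) (ham c p s g))

end

end BiHam

/-!
Since `H_f` starts with an arbitrary function `f` of `u`, commutativity of the `H_f` is a strong
condition. A skew operator for which all `H_f` commute satisfies the Jacobi identity: by induction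
on the order in `ε`, the Jacobiator is a local trilinear form of positive degree in `u_x, u_xx, …`
which vanishes on functions of `u`, and such a form is zero. Likewise, a flow commuting with the
hierarchy is determined by its leading term. Hence `f'' = q g'' + ½ q' g'` forces the flows
`∂_x δH_f` and `L δH_g` to agree, and this recursion determines `L` order by order.

The recursion is solved by `q ∂ + ½ q' u_x + ε² L₂ + ε⁴ L₄`, with `L₂` and `L₄` sums of operators
`∂^k (a ∂ + ½ a_x) ∂^k`, up to a defect at order `ε⁴` which is linear in
`w = p q'/2 - c c' q'/384 + c² q''/1920`. The defect contains `w g'' u⁽⁵⁾`, which no change of `L₄`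
can absorb, so a bihamiltonian structure exists exactly when `w = 0`. This is the formula for
`p`; read as an equation for `q` it is `(log |q'|)' = 5 c'/c - 960 p/c²`, which determines `q` up to
an affine transformation, and `L₂` and `L₄` are linear in `q'` and its derivatives.
-/

namespace BiHam

open MvPolynomial (pderiv)

noncomputable section

variable {I : Opens ℝ}

/-! ### Smooth functions -/

namespace Smooth

theorem ext {f g : Smooth I} (h : ∀ u, f u = g u) : f = g := Subtype.ext (funext h)

@[simp] theorem add_apply (f g : Smooth I) (u : I) : (f + g) u = f u + g u := rfl
@[simp] theorem mul_apply (f g : Smooth I) (u : I) : (f * g) u = f u * g u := rfl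
@[simp] theorem sub_apply (f g : Smooth I) (u : I) : (f - g) u = f u - g u := rfl
@[simp] theorem zero_apply (u : I) : (0 : Smooth I) u = 0 := rfl
@[simp] theorem one_apply (u : I) : (1 : Smooth I) u = 1 := rfl
@[simp] theorem smul_apply (r : ℝ) (f : Smooth I) (u : I) : (r • f) u = r * f u := rfl
@[simp] theorem algebraMap_apply (r : ℝ) (u : I) : (algebraMap ℝ (Smooth I) r) u = r := rfl
@[simp] theorem pow_apply (f : Smooth I) (n : ℕ) (u : I) : (f ^ n) u = f u ^ n := rfl

/-- The restriction to `I` of a function that is smooth on `I`. -/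
def mk (g : ℝ → ℝ) (hg : ContDiffOn ℝ ∞ g I) : Smooth I := ⟨fun u => g u, g, hg, fun _ => rfl⟩

@[simp] theorem mk_apply (g : ℝ → ℝ) (hg : ContDiffOn ℝ ∞ g I) (u : I) : mk g hg u = g u := rfl

theorem exists_eq_mk (f : Smooth I) : ∃ g hg, f = mk g hg := by
  obtain ⟨f, g, hg, h⟩ := f
  exact ⟨g, hg, Smooth.ext h⟩

theorem der_apply {f : Smooth I} {g : ℝ → ℝ} (h : ∀ u : I, f u = g u) (u : I) :
    der f u = deriv g u := by
  apply Filter.EventuallyEq.deriv_eq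
  filter_upwards [I.isOpen.mem_nhds u.2] with x hx
  exact (Subtype.val_injective.extend_apply (f : I → ℝ) 0 ⟨x, hx⟩).trans (h ⟨x, hx⟩)

theorem hasDerivAt_of_contDiffOn {g : ℝ → ℝ} (hg : ContDiffOn ℝ ∞ g I) (u : I) :
    HasDerivAt g (deriv g u) u :=
  ((hg.differentiableOn (by simp)).differentiableAt (I.isOpen.mem_nhds u.2)).hasDerivAt

theorem der_mk_apply {g : ℝ → ℝ} (hg : ContDiffOn ℝ ∞ g I) (u : I) :
    der (mk g hg) u = deriv g u := der_apply (fun _ => rfl) u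

theorem der_add (f g : Smooth I) : der (f + g) = der f + der g := by
  obtain ⟨a, ha, rfl⟩ := exists_eq_mk f
  obtain ⟨b, hb, rfl⟩ := exists_eq_mk g
  refine Smooth.ext fun u => ?_
  rw [add_apply, der_mk_apply, der_mk_apply, der_apply (g := a + b) fun _ => rfl]
  exact ((hasDerivAt_of_contDiffOn ha u).add (hasDerivAt_of_contDiffOn hb u)).deriv

theorem der_mul (f g : Smooth I) : der (f * g) = f * der g + g * der f := by
  obtain ⟨a, ha, rfl⟩ := exists_eq_mk f
  obtain ⟨b, hb, rfl⟩ := exists_eq_mk g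
  refine Smooth.ext fun u => ?_
  rw [add_apply, mul_apply, mul_apply, der_mk_apply, der_mk_apply,
    der_apply (g := a * b) fun _ => rfl]
  rw [((hasDerivAt_of_contDiffOn ha u).mul (hasDerivAt_of_contDiffOn hb u)).deriv, mk_apply,
    mk_apply]
  ring

theorem der_smul (r : ℝ) (f : Smooth I) : der (r • f) = r • der f := by
  obtain ⟨a, ha, rfl⟩ := exists_eq_mk f
  refine Smooth.ext fun u => ?_
  rw [smul_apply, der_mk_apply, der_apply (g := fun x => r * a x) fun _ => rfl]
  exact ((hasDerivAt_of_contDiffOn ha u).const_mul r).deriv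

end Smooth

/-- The derivative `f ↦ f'`, bundled as a derivation of `C^∞(I)`. -/
def derDerivation : Derivation ℝ (Smooth I) (Smooth I) :=
  Derivation.mk' ⟨⟨der, Smooth.der_add⟩, Smooth.der_smul⟩ fun f g => Smooth.der_mul f g

@[simp] theorem derDerivation_apply (f : Smooth I) : derDerivation f = der f := rfl

namespace Smooth

@[simp] theorem der_zero : der (0 : Smooth I) = 0 := map_zero derDerivation
@[simp] theorem der_one : der (1 : Smooth I) = 0 := Derivation.map_one_eq_zero derDerivation
theorem der_sub (f g : Smooth I) : der (f - g) = der f - der g := map_sub derDerivation f g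
theorem der_algebraMap (r : ℝ) : der (algebraMap ℝ (Smooth I) r) = 0 :=
  derDerivation.map_algebraMap r

theorem exists_der_eq (hI : IsConnected (I : Set ℝ)) (f : Smooth I) :
    ∃ g : Smooth I, der g = f := by
  obtain ⟨a, ha, rfl⟩ := exists_eq_mk f
  obtain ⟨u₀, hu₀⟩ := hI.nonempty
  have hord := hI.isPreconnected.ordConnected
  have hd : ∀ u ∈ (I : Set ℝ), HasDerivAt (fun v => ∫ t in u₀..v, a t) (a u) u := by
    intro u hu
    have hc : ContinuousOn a (Set.uIcc u₀ u) := ha.continuousOn.mono (hord.uIcc_subset hu₀ hu)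
    refine intervalIntegral.integral_hasDerivAt_right hc.intervalIntegrable ?_
      (ha.continuousOn.continuousAt (I.isOpen.mem_nhds hu))
    exact ha.continuousOn.stronglyMeasurableAtFilter I.isOpen u hu
  have hG : ContDiffOn ℝ ∞ (fun v => ∫ t in u₀..v, a t) I := by
    refine (contDiffOn_infty_iff_deriv_of_isOpen I.isOpen).2
      ⟨fun u hu => (hd u hu).differentiableAt.differentiableWithinAt, ?_⟩
    exact ha.congr fun u hu => (hd u hu).deriv
  exact ⟨mk _ hG, Smooth.ext fun u => by rw [der_mk_apply, (hd u u.2).deriv, mk_apply]⟩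

theorem exists_eq_of_der_eq_zero (hI : IsConnected (I : Set ℝ)) {f : Smooth I} (h : der f = 0) :
    ∃ r : ℝ, f = algebraMap ℝ _ r := by
  obtain ⟨a, ha, rfl⟩ := exists_eq_mk f
  obtain ⟨r, hr⟩ := I.isOpen.exists_is_const_of_deriv_eq_zero hI.isPreconnected
    (ha.differentiableOn (by simp))
    fun u hu => (der_mk_apply ha ⟨u, hu⟩).symm.trans (congrFun (congrArg Subtype.val h) _)
  exact ⟨r, Smooth.ext fun u => hr u.1 u.2⟩

theorem exists_mul_eq_one {f : Smooth I} (h : ∀ u, f u ≠ 0) : ∃ g : Smooth I, f * g = 1 := by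
  obtain ⟨a, ha, rfl⟩ := exists_eq_mk f
  exact ⟨mk _ (ha.inv fun u hu => h ⟨u, hu⟩), Smooth.ext fun u => mul_inv_cancel₀ (h u)⟩

theorem exists_exp (f : Smooth I) : ∃ g : Smooth I, (∀ u, g u ≠ 0) ∧ der g = der f * g := by
  obtain ⟨a, ha, rfl⟩ := exists_eq_mk f
  refine ⟨mk _ ha.exp, fun u => (Real.exp_pos _).ne', Smooth.ext fun u => ?_⟩
  rw [mul_apply, der_mk_apply, der_mk_apply, (hasDerivAt_of_contDiffOn ha u).exp.deriv, mul_comm]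
  rfl

/-- The divided power `(u - a)^k / k!`, the function used to test operators at the point `a`. -/
def divPow (a : I) (k : ℕ) : Smooth I :=
  mk (fun u => (u - a.1) ^ k / (k.factorial : ℝ)) (by fun_prop)

theorem der_divPow_succ (a : I) (k : ℕ) : der (divPow a (k + 1)) = divPow a k := by
  refine Smooth.ext fun u => ?_
  rw [divPow, der_mk_apply]
  have h : HasDerivAt (fun u : ℝ => (u - a.1) ^ (k + 1) / ((k + 1).factorial : ℝ))
      (((k + 1 : ℕ) : ℝ) * (u - a.1) ^ k * 1 / ((k + 1).factorial : ℝ)) u := by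
    simpa using (((hasDerivAt_id (u : ℝ)).sub_const a.1).pow (k + 1)).div_const _
  rw [h.deriv, divPow, mk_apply, Nat.factorial_succ]
  push_cast
  field_simp

theorem divPow_apply_zero (u : I) : divPow u 0 u = 1 := by simp [divPow]

theorem divPow_apply_succ (u : I) (k : ℕ) : divPow u (k + 1) u = 0 := by
  simp [divPow]

/-- Evaluation of smooth functions at a point. -/
def evalHom (u : I) : Smooth I →ₐ[ℝ] ℝ where
  toFun f := f u
  map_one' := rfl
  map_mul' _ _ := rfl
  map_zero' := rfl
  map_add' _ _ := rfl
  commutes' _ := rfl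

@[simp] theorem evalHom_apply (u : I) (f : Smooth I) : evalHom u f = f u := rfl

end Smooth

/-! ### Differential polynomials -/

theorem coeff_partialU (F : DiffPoly I) (m : ℕ →₀ ℕ) :
    (partialU F).coeff m = der (F.coeff m) := by
  rw [partialU, MvPolynomial.coeff_sum]
  simp only [MvPolynomial.coeff_monomial]
  rw [Finset.sum_ite_eq']
  split_ifs with h
  · rfl
  · rw [MvPolynomial.notMem_support_iff.1 h, Smooth.der_zero]

/-- `∂/∂u`, bundled as a derivation. -/
def partialUDerivation : Derivation ℝ (DiffPoly I) (DiffPoly I) :=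
  Derivation.mk'
    ⟨⟨partialU, fun F G => by ext1 m; simp [coeff_partialU, Smooth.der_add]⟩,
      fun r F => by ext1 m; simp [coeff_partialU, Smooth.der_smul]⟩
    fun F G => by
      ext1 m
      simp only [LinearMap.coe_mk, AddHom.coe_mk, smul_eq_mul, mul_comm G, MvPolynomial.coeff_add,
        coeff_partialU, MvPolynomial.coeff_mul]
      rw [← derDerivation_apply, map_sum, ← Finset.sum_add_distrib]
      refine Finset.sum_congr rfl fun x _ => ?_
      rw [derDerivation_apply, Smooth.der_mul, mul_comm (der _)]

@[simp] theorem partialUDerivation_apply (F : DiffPoly I) : partialUDerivation F = partialU F := rfl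

@[simp] theorem partialU_fn (f : Smooth I) : partialU (fn f) = fn (der f) := by
  classical
  ext1 m
  rw [coeff_partialU, fn, fn, MvPolynomial.coeff_C, MvPolynomial.coeff_C]
  split_ifs <;> simp

@[simp] theorem partialU_jet (n : ℕ) : partialU (jet n : DiffPoly I) = 0 := by
  classical
  ext1 m
  rw [coeff_partialU, jet, MvPolynomial.coeff_X, MvPolynomial.coeff_zero]
  split_ifs <;> simp

@[simp] theorem pderiv_fn (n : ℕ) (f : Smooth I) : pderiv n (fn f) = 0 :=
  MvPolynomial.pderiv_C

theorem pderiv_jet (n m : ℕ) : pderiv n (jet m : DiffPoly I) = if m = n then 1 else 0 := by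
  rw [jet, MvPolynomial.pderiv_X, Pi.single_apply]

/-- The vector field on jet space with component `a` along `u` and `b n` along `u^{(n+1)}`. -/
def vectorField (a : DiffPoly I) (b : ℕ → DiffPoly I) : Derivation ℝ (DiffPoly I) (DiffPoly I) :=
  a • partialUDerivation + (MvPolynomial.mkDerivation (Smooth I) b).restrictScalars ℝ

theorem vectorField_apply {a : DiffPoly I} {b : ℕ → DiffPoly I} {F : DiffPoly I} {s : Finset ℕ}
    (hs : F.vars ⊆ s) :
    vectorField a b F = a * partialU F + ∑ n ∈ s, b n * pderiv n F := by
  have sum_apply (G : DiffPoly I) :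
      (∑ n ∈ s, b n • pderiv n : Derivation (Smooth I) (DiffPoly I) (DiffPoly I)) G =
        ∑ n ∈ s, b n * pderiv n G := by
    rw [← Derivation.coeFnAddMonoidHom_apply, map_sum, Finset.sum_apply]
    rfl
  have h : MvPolynomial.mkDerivation (Smooth I) b F = ∑ n ∈ s, b n * pderiv n F := by
    rw [← sum_apply]
    refine MvPolynomial.derivation_eq_of_forall_mem_vars fun i hi => ?_
    rw [MvPolynomial.mkDerivation_X, sum_apply, Finset.sum_eq_single_of_mem i (hs hi)]
    · rw [MvPolynomial.pderiv_X_self, mul_one]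
    · intro n _ hn
      rw [MvPolynomial.pderiv_X_of_ne hn.symm, mul_zero]
  simp [vectorField, h]

@[simp] theorem vectorField_fn (a : DiffPoly I) (b : ℕ → DiffPoly I) (f : Smooth I) :
    vectorField a b (fn f) = a * fn (der f) := by
  rw [vectorField_apply (s := ∅) (by simp [fn])]
  simp

@[simp] theorem vectorField_jet (a : DiffPoly I) (b : ℕ → DiffPoly I) (n : ℕ) :
    vectorField a b (jet n) = b n := by
  rw [vectorField, Derivation.add_apply, Derivation.smul_apply, partialUDerivation_apply,
    partialU_jet]
  simp [jet]

theorem derivation_ext {d e : Derivation ℝ (DiffPoly I) (DiffPoly I)}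
    (hfn : ∀ f, d (fn f) = e (fn f)) (hjet : ∀ n, d (jet n) = e (jet n)) : d = e := by
  ext1 F
  induction F using MvPolynomial.induction_on with
  | C f => exact hfn f
  | add F G hF hG => rw [map_add, map_add, hF, hG]
  | mul_X F n hF => rw [d.leibniz, e.leibniz, hF, show d (MvPolynomial.X n) = _ from hjet n]; rfl

/-- The total derivative `totalD`, bundled as a derivation. -/
def dxDerivation : Derivation ℝ (DiffPoly I) (DiffPoly I) :=
  vectorField (jet 0) fun n => jet (n + 1)

/-- The total derivative `totalD`, bundled as a linear map so that its powers and their adjoints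
`(-dx) ^ k` can be written. -/
def dx : Module.End ℝ (DiffPoly I) := dxDerivation.toLinearMap

@[simp] theorem dxDerivation_apply (F : DiffPoly I) : dxDerivation F = dx F := rfl

theorem totalD_eq_dx (F : DiffPoly I) : totalD F = dx F := (vectorField_apply subset_rfl).symm

theorem iterate_totalD (k : ℕ) (F : DiffPoly I) : totalD^[k] F = (dx ^ k) F := by
  rw [Module.End.pow_apply]
  exact congrArg (fun t : DiffPoly I → DiffPoly I => t^[k] F) (funext totalD_eq_dx)

@[simp] theorem dx_fn (f : Smooth I) : dx (fn f) = fn (der f) * jet 0 :=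
  (vectorField_fn _ _ _).trans (mul_comm _ _)

@[simp] theorem dx_jet (n : ℕ) : dx (jet n : DiffPoly I) = jet (n + 1) := vectorField_jet _ _ _

theorem dx_mul (F G : DiffPoly I) : dx (F * G) = F * dx G + G * dx F := dxDerivation.leibniz F G

@[simp] theorem dx_zero : dx (0 : DiffPoly I) = 0 := map_zero dx

@[simp] theorem dx_one : dx (1 : DiffPoly I) = 0 := dxDerivation.map_one_eq_zero

theorem dx_pow_succ (k : ℕ) (F : DiffPoly I) : (dx ^ (k + 1)) F = dx ((dx ^ k) F) := by
  rw [pow_succ', Module.End.mul_apply]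

theorem neg_dx_pow_succ (k : ℕ) (F : DiffPoly I) :
    ((-dx) ^ (k + 1)) F = -dx (((-dx) ^ k) F) := by
  rw [pow_succ', Module.End.mul_apply, LinearMap.neg_apply]

theorem neg_dx_pow (k : ℕ) (F : DiffPoly I) : ((-dx) ^ k) F = (-1) ^ k * (dx ^ k) F := by
  rcases k.even_or_odd with hk | hk
  · rw [hk.neg_pow (dx (I := I)), hk.neg_one_pow, one_mul]
  · rw [hk.neg_pow (dx (I := I)), hk.neg_one_pow, neg_one_mul, LinearMap.neg_apply]

theorem derivation_dx_of_generators {d e : Derivation ℝ (DiffPoly I) (DiffPoly I)}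
    (hfn : ∀ f, d (dx (fn f)) = dx (d (fn f)) + e (fn f))
    (hjet : ∀ n, d (dx (jet n)) = dx (d (jet n)) + e (jet n)) (F : DiffPoly I) :
    d (dx F) = dx (d F) + e F := by
  have h : ⁅d, dxDerivation⁆ = e := by
    refine derivation_ext (fun f => ?_) fun n => ?_
    · rw [Derivation.commutator_apply, sub_eq_iff_eq_add']; exact hfn f
    · rw [Derivation.commutator_apply, sub_eq_iff_eq_add']; exact hjet n
  rw [← h, Derivation.commutator_apply, dxDerivation_apply, dxDerivation_apply]
  abel

theorem partialU_dx (F : DiffPoly I) : partialU (dx F) = dx (partialU F) := by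
  refine (derivation_dx_of_generators (d := partialUDerivation) (e := 0)
    (fun f => ?_) (fun n => ?_) F).trans (add_zero _)
  · rw [dx_fn, Derivation.leibniz]
    simp [mul_comm]
  · simp

theorem pderiv_zero_dx (F : DiffPoly I) : pderiv 0 (dx F) = dx (pderiv 0 F) + partialU F := by
  refine derivation_dx_of_generators (d := (pderiv 0).restrictScalars ℝ) (e := partialUDerivation)
    (fun f => ?_) (fun n => ?_) F
  · simp [pderiv_jet]
  · simp [pderiv_jet, apply_ite dx]

theorem pderiv_succ_dx (k : ℕ) (F : DiffPoly I) :
    pderiv (k + 1) (dx F) = dx (pderiv (k + 1) F) + pderiv k F := by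
  refine derivation_dx_of_generators (d := (pderiv (k + 1)).restrictScalars ℝ)
    (e := (pderiv k).restrictScalars ℝ) (fun f => ?_) (fun n => ?_) F
  · simp [pderiv_jet]
  · simp [pderiv_jet, apply_ite dx]

theorem varD_eq {F : DiffPoly I} {s : Finset ℕ} (hs : F.vars ⊆ s) :
    varD F = partialU F + ∑ n ∈ s, ((-dx) ^ (n + 1)) (pderiv n F) := by
  simp only [varD, iterate_totalD, ← neg_dx_pow]
  congr 1
  refine Finset.sum_subset hs fun n _ hn => ?_
  rw [MvPolynomial.pderiv_eq_zero_of_notMem_vars hn, map_zero]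

theorem exists_vars_subset_range (F : DiffPoly I) :
    ∃ N, ∀ M, N ≤ M → F.vars ⊆ Finset.range M := by
  obtain ⟨N, hN⟩ := F.vars.exists_nat_subset_range
  exact ⟨N, fun M h => hN.trans (Finset.range_mono h)⟩

theorem varD_add (F G : DiffPoly I) : varD (F + G) = varD F + varD G := by
  classical
  have h : (F + G).vars ⊆ F.vars ∪ G.vars := MvPolynomial.vars_add_subset F G
  rw [varD_eq h, varD_eq (Finset.subset_union_left : F.vars ⊆ F.vars ∪ G.vars),
    varD_eq (Finset.subset_union_right : G.vars ⊆ F.vars ∪ G.vars), ← partialUDerivation_apply]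
  simp only [map_add, Finset.sum_add_distrib, partialUDerivation_apply]
  ring

theorem varD_fn (f : Smooth I) : varD (fn f) = fn (der f) := by
  rw [varD_eq (s := ∅) (by simp [fn])]
  simp

theorem varD_zero : varD (0 : DiffPoly I) = 0 := by simpa [fn] using varD_fn (0 : Smooth I)

theorem varD_dx (F : DiffPoly I) : varD (dx F) = 0 := by
  obtain ⟨N, hN⟩ := exists_vars_subset_range F
  obtain ⟨M, hM⟩ := exists_vars_subset_range (dx F)
  have telescope (K : ℕ) : partialU (dx F) +
      ∑ n ∈ Finset.range (K + 1), ((-dx) ^ (n + 1)) (pderiv n (dx F)) =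
        -((-dx) ^ (K + 2)) (pderiv K F) := by
    induction K with
    | zero =>
      rw [Finset.sum_range_one, pderiv_zero_dx, partialU_dx]
      simp [neg_dx_pow_succ]
    | succ K ih =>
      have hdx : ((-dx) ^ (K + 2)) (dx (pderiv (K + 1) F)) =
          -((-dx) ^ (K + 3)) (pderiv (K + 1) F) := by
        rw [pow_succ _ (K + 2)]
        simp
      rw [Finset.sum_range_succ, ← add_assoc, ih, pderiv_succ_dx, map_add, hdx]
      abel
  have hzero : pderiv (max N M) F = 0 :=
    MvPolynomial.pderiv_eq_zero_of_notMem_vars fun h =>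
      (Finset.mem_range.1 (hN _ (le_max_left N M) h)).false
  rw [varD_eq (hM (max N M + 1) (by omega)), telescope, hzero, map_zero, neg_zero]

/-! ### Local functionals -/

/-- Local functionals: densities modulo total derivatives. -/
abbrev LocalFunctional (I : Opens ℝ) : Type :=
  DiffPoly I ⧸ LinearMap.range (dx : Module.End ℝ (DiffPoly I))

/-- The local functional `∫ F dx` with density `F`. -/
def loc : DiffPoly I →ₗ[ℝ] LocalFunctional I := Submodule.mkQ _

theorem loc_eq_zero_iff {F : DiffPoly I} : loc F = 0 ↔ ∃ Q, F = totalD Q := by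
  rw [loc, Submodule.mkQ_apply, Submodule.Quotient.mk_eq_zero, LinearMap.mem_range]
  simp only [totalD_eq_dx, eq_comm]

theorem isNull_iff_loc {F : Ser (DiffPoly I)} : IsNull F ↔ ∀ n, loc (F n) = 0 :=
  forall_congr' fun _ => loc_eq_zero_iff.symm

theorem varD_eq_zero_of_loc {F : DiffPoly I} (h : loc F = 0) : varD F = 0 := by
  obtain ⟨Q, rfl⟩ := loc_eq_zero_iff.1 h
  rw [totalD_eq_dx, varD_dx]

@[simp] theorem loc_dx (F : DiffPoly I) : loc (dx F) = 0 :=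
  loc_eq_zero_iff.2 ⟨F, (totalD_eq_dx F).symm⟩

theorem loc_mul_dx (F G : DiffPoly I) : loc (F * dx G) = -loc (dx F * G) := by
  have h := loc_dx (F * G)
  rw [dx_mul, map_add, mul_comm G] at h
  exact eq_neg_of_add_eq_zero_left h

theorem loc_mul_dx_pow (k : ℕ) (F G : DiffPoly I) :
    loc (F * (dx ^ k) G) = loc (((-dx) ^ k) F * G) := by
  induction k generalizing F with
  | zero => simp
  | succ k ih =>
    rw [dx_pow_succ, loc_mul_dx, ← map_neg, ← neg_mul, ih, pow_succ]
    rfl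

/-- The evolutionary vector field `u_t = X`. -/
def pr (X : DiffPoly I) : Derivation ℝ (DiffPoly I) (DiffPoly I) :=
  vectorField X fun n => (dx ^ (n + 1)) X

@[simp] theorem pr_fn (X : DiffPoly I) (f : Smooth I) : pr X (fn f) = X * fn (der f) :=
  vectorField_fn _ _ _

@[simp] theorem pr_jet (X : DiffPoly I) (n : ℕ) : pr X (jet n) = (dx ^ (n + 1)) X :=
  vectorField_jet _ _ _

theorem pr_apply {X F : DiffPoly I} {s : Finset ℕ} (hs : F.vars ⊆ s) :
    pr X F = X * partialU F + ∑ n ∈ s, (dx ^ (n + 1)) X * pderiv n F :=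
  vectorField_apply hs

theorem loc_varD_mul (F X : DiffPoly I) : loc (varD F * X) = loc (pr X F) := by
  rw [pr_apply subset_rfl, varD_eq subset_rfl, add_mul, map_add, map_add, Finset.sum_mul, map_sum,
    map_sum, mul_comm X]
  congr 1
  refine Finset.sum_congr rfl fun n _ => ?_
  rw [← loc_mul_dx_pow, mul_comm]

theorem pr_dx (X F : DiffPoly I) : pr X (dx F) = dx (pr X F) := by
  refine (derivation_dx_of_generators (e := 0) (fun f => ?_) (fun n => ?_) F).trans (add_zero _)
  · simp only [pr_fn, dx_fn, dx_mul, Derivation.leibniz, pr_jet, Derivation.zero_apply,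
      smul_eq_mul, zero_add, add_zero, pow_one]
    ring
  · simp [dx_pow_succ]

theorem pr_dx_pow (k : ℕ) (X F : DiffPoly I) : pr X ((dx ^ k) F) = (dx ^ k) (pr X F) := by
  induction k with
  | zero => simp
  | succ k ih => rw [dx_pow_succ, pr_dx, ih, dx_pow_succ]

theorem loc_pr_congr {F G : DiffPoly I} (h : loc F = loc G) (X : DiffPoly I) :
    loc (pr X F) = loc (pr X G) := by
  rw [← sub_eq_zero, ← map_sub] at h
  obtain ⟨Q, hQ⟩ := loc_eq_zero_iff.1 h
  rw [← sub_eq_zero, ← map_sub, ← map_sub, hQ, totalD_eq_dx, pr_dx, loc_dx]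

theorem pr_commutator (X Y F : DiffPoly I) :
    pr X (pr Y F) - pr Y (pr X F) = pr (pr X Y - pr Y X) F := by
  have h : ⁅pr X, pr Y⁆ = pr (pr X Y - pr Y X) := by
    refine derivation_ext (fun f => ?_) fun n => ?_
    · simp only [Derivation.commutator_apply, pr_fn, Derivation.leibniz, smul_eq_mul]
      ring
    · simp [Derivation.commutator_apply, pr_dx_pow]
  exact congrArg (fun d => d F) h

theorem loc_pr_varD_mul_comm (F X Y : DiffPoly I) :
    loc (pr X (varD F) * Y) = loc (pr Y (varD F) * X) := by
  have h (X Y : DiffPoly I) : loc (pr X (varD F) * Y) =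
      loc (pr X (pr Y F)) - loc (varD F * pr X Y) := by
    rw [← loc_pr_congr (loc_varD_mul F Y), Derivation.leibniz, map_add, smul_eq_mul, smul_eq_mul,
      mul_comm Y]
    abel
  rw [h X Y, h Y X, sub_eq_sub_iff_sub_eq_sub, ← map_sub, ← map_sub, pr_commutator, ← mul_sub,
    loc_varD_mul]

/-! ### Degrees -/

/-- The ideal of differential polynomials all of whose monomials have degree at least `d`. -/
def degGE (d : ℕ) : Ideal (DiffPoly I) where
  carrier := {F | ∀ m, F.coeff m ≠ 0 → d ≤ Finsupp.weight (fun n : ℕ => n + 1) m}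
  zero_mem' := by simp
  add_mem' := by
    intro F G hF hG m hm
    rw [MvPolynomial.coeff_add] at hm
    by_cases h : F.coeff m = 0
    · exact hG m (by simpa [h] using hm)
    · exact hF m h
  smul_mem' := by
    classical
    intro F G hG m hm
    rw [smul_eq_mul, MvPolynomial.coeff_mul] at hm
    obtain ⟨x, hx, hne⟩ := Finset.exists_ne_zero_of_sum_ne_zero hm
    rw [← Finset.HasAntidiagonal.mem_antidiagonal.1 hx, map_add]
    exact (hG _ (right_ne_zero_of_mul hne)).trans (Nat.le_add_left _ _)

theorem degGE_anti {d e : ℕ} (h : d ≤ e) {F : DiffPoly I} (hF : F ∈ degGE e) : F ∈ degGE d :=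
  fun m hm => h.trans (hF m hm)

theorem mem_degGE_zero (F : DiffPoly I) : F ∈ degGE 0 := fun _ _ => Nat.zero_le _

theorem mul_mem_degGE {d e k : ℕ} (hk : k ≤ d + e) {F G : DiffPoly I} (hF : F ∈ degGE d)
    (hG : G ∈ degGE e) : F * G ∈ degGE k := by
  classical
  intro m hm
  rw [MvPolynomial.coeff_mul] at hm
  obtain ⟨x, hx, hne⟩ := Finset.exists_ne_zero_of_sum_ne_zero hm
  rw [← Finset.HasAntidiagonal.mem_antidiagonal.1 hx, map_add]
  exact hk.trans (add_le_add (hF _ (left_ne_zero_of_mul hne)) (hG _ (right_ne_zero_of_mul hne)))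

theorem partialU_mem_degGE {d : ℕ} {F : DiffPoly I} (hF : F ∈ degGE d) : partialU F ∈ degGE d := by
  intro m hm
  refine hF m fun h => hm ?_
  rw [coeff_partialU, h, Smooth.der_zero]

theorem pderiv_mem_degGE {d : ℕ} {F : DiffPoly I} (hF : F ∈ degGE d) (n : ℕ) :
    pderiv n F ∈ degGE (d - (n + 1)) := by
  intro m hm
  rw [MvPolynomial.coeff_pderiv] at hm
  have hweight := hF _ (left_ne_zero_of_mul hm)
  rw [map_add, Finsupp.weight_single, one_smul] at hweight
  omega

theorem HasDegree.mem_degGE {F : DiffPoly I} {d : ℕ} (h : HasDegree F d) : F ∈ degGE d :=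
  fun _ hm => (h hm).ge

theorem hasDegree_fn (f : Smooth I) : HasDegree (fn f) 0 :=
  MvPolynomial.isWeightedHomogeneous_C _ _

theorem hasDegree_jet (n : ℕ) : HasDegree (jet n : DiffPoly I) (n + 1) :=
  MvPolynomial.isWeightedHomogeneous_X _ _ _

theorem vectorField_mem_degGE {d e k : ℕ} (hk : k ≤ d + e) {a : DiffPoly I} {b : ℕ → DiffPoly I}
    (ha : a ∈ degGE e) (hb : ∀ n, b n ∈ degGE (e + (n + 1))) {F : DiffPoly I} (hF : F ∈ degGE d) :
    vectorField a b F ∈ degGE k := by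
  rw [vectorField_apply subset_rfl]
  refine add_mem (mul_mem_degGE (by omega) ha (partialU_mem_degGE hF)) (sum_mem fun n _ => ?_)
  exact mul_mem_degGE (by omega) (hb n) (pderiv_mem_degGE hF n)

theorem dx_mem_degGE {d : ℕ} {F : DiffPoly I} (hF : F ∈ degGE d) : dx F ∈ degGE (d + 1) :=
  vectorField_mem_degGE le_rfl (hasDegree_jet 0).mem_degGE
    (fun n => degGE_anti (by omega) (hasDegree_jet (n + 1)).mem_degGE) hF

theorem dx_pow_mem_degGE {d : ℕ} {F : DiffPoly I} (hF : F ∈ degGE d) (k : ℕ) :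
    (dx ^ k) F ∈ degGE (d + k) := by
  induction k with
  | zero => exact hF
  | succ k ih => rw [dx_pow_succ]; exact dx_mem_degGE ih

theorem neg_dx_pow_mem_degGE {d : ℕ} {F : DiffPoly I} (hF : F ∈ degGE d) (k : ℕ) :
    ((-dx) ^ k) F ∈ degGE (d + k) := by
  rw [neg_dx_pow]
  exact Ideal.mul_mem_left _ _ (dx_pow_mem_degGE hF k)

theorem pr_mem_degGE {d e k : ℕ} (hk : k ≤ d + e) {X F : DiffPoly I} (hX : X ∈ degGE e)
    (hF : F ∈ degGE d) : pr X F ∈ degGE k :=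
  vectorField_mem_degGE hk hX (fun n => dx_pow_mem_degGE hX (n + 1)) hF

theorem HasDegree.dx {F : DiffPoly I} {d : ℕ} (hF : HasDegree F d) : HasDegree (dx F) (d + 1) := by
  have hpartialU : HasDegree (partialU F) d := fun m hm => hF fun h => hm <| by
    rw [coeff_partialU, h, Smooth.der_zero]
  rw [← totalD_eq_dx, totalD, add_comm d]
  refine ((hasDegree_jet 0).mul hpartialU).add (.sum _ _ _ fun n hn => ?_)
  obtain ⟨m, hm, hnm⟩ := (MvPolynomial.mem_vars_iff_mem_support n).1 hn
  have hle : n + 1 ≤ d := by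
    rw [← hF (MvPolynomial.mem_support_iff.1 hm)]
    exact Finsupp.le_weight_of_ne_zero' _ (Finsupp.mem_support_iff.1 hnm)
  have hpderiv : HasDegree (pderiv n F) (d - (n + 1)) :=
    MvPolynomial.IsWeightedHomogeneous.pderiv hF (by omega)
  convert (hasDegree_jet (n + 1)).mul hpderiv using 1
  omega

/-! ### Evaluation at a point -/

/-- Evaluation of the coefficients of a differential polynomial at a point of `I`. -/
def atPoint (u : I) : DiffPoly I →+* MvPolynomial ℕ ℝ :=
  MvPolynomial.map (Smooth.evalHom u).toRingHom

theorem coeff_atPoint (u : I) (F : DiffPoly I) (m : ℕ →₀ ℕ) :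
    (atPoint u F).coeff m = F.coeff m u := MvPolynomial.coeff_map _ _ _

@[simp] theorem atPoint_fn (u : I) (f : Smooth I) : atPoint u (fn f) = MvPolynomial.C (f u) :=
  MvPolynomial.map_C _ _

@[simp] theorem atPoint_jet (u : I) (n : ℕ) : atPoint u (jet n) = MvPolynomial.X n :=
  MvPolynomial.map_X _ _

theorem ext_atPoint {F G : DiffPoly I} (h : ∀ u, atPoint u F = atPoint u G) : F = G := by
  ext1 m
  refine Smooth.ext fun u => ?_
  rw [← coeff_atPoint, h, coeff_atPoint]

theorem neg_dx_pow_succ_divPow_mul (u : I) (j k : ℕ) (Z : DiffPoly I) :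
    ((-dx) ^ (j + 1)) (fn (Smooth.divPow u (k + 1)) * Z) =
      -(((-dx) ^ j) (fn (Smooth.divPow u (k + 1)) * dx Z) +
        ((-dx) ^ j) (fn (Smooth.divPow u k) * (jet 0 * Z))) := by
  rw [pow_succ, Module.End.mul_apply, LinearMap.neg_apply, map_neg, dx_mul, dx_fn,
    Smooth.der_divPow_succ, map_add, mul_comm Z, mul_assoc]

theorem atPoint_neg_dx_pow_divPow_mul_of_lt (u : I) {j k : ℕ} (h : j < k) (Z : DiffPoly I) :
    atPoint u (((-dx) ^ j) (fn (Smooth.divPow u k) * Z)) = 0 := by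
  obtain ⟨k, rfl⟩ := Nat.exists_eq_add_one_of_ne_zero h.ne_bot
  induction j generalizing k Z with
  | zero => simp [Smooth.divPow_apply_succ]
  | succ j ih =>
    obtain ⟨k, rfl⟩ := Nat.exists_eq_add_one_of_ne_zero (show k ≠ 0 by omega)
    rw [neg_dx_pow_succ_divPow_mul, map_neg, map_add, ih _ _ (by omega), ih _ _ (by omega),
      add_zero, neg_zero]

theorem atPoint_neg_dx_pow_divPow_mul (u : I) (k : ℕ) (Z : DiffPoly I) :
    atPoint u (((-dx) ^ k) (fn (Smooth.divPow u k) * Z)) =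
      (-MvPolynomial.X 0) ^ k * atPoint u Z := by
  induction k generalizing Z with
  | zero => simp [Smooth.divPow_apply_zero]
  | succ k ih =>
    rw [neg_dx_pow_succ_divPow_mul, map_neg, map_add,
      atPoint_neg_dx_pow_divPow_mul_of_lt u k.lt_succ_self, ih, map_mul, atPoint_jet]
    ring

theorem atPoint_dx_pow_divPow_of_lt (u : I) {j k : ℕ} (h : j < k) :
    atPoint u ((dx ^ j) (fn (Smooth.divPow u k))) = 0 := by
  have hneg := atPoint_neg_dx_pow_divPow_mul_of_lt u h 1
  rw [mul_one, neg_dx_pow, map_mul] at hneg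
  exact (mul_eq_zero.1 hneg).resolve_left (by simp)

theorem atPoint_dx_pow_divPow (u : I) (k : ℕ) :
    atPoint u ((dx ^ k) (fn (Smooth.divPow u k))) = MvPolynomial.X 0 ^ k := by
  have hneg := atPoint_neg_dx_pow_divPow_mul u k 1
  rw [mul_one, neg_dx_pow, map_mul, map_one, mul_one,
    neg_pow (MvPolynomial.X 0 : MvPolynomial ℕ ℝ), map_pow, map_neg, map_one] at hneg
  exact mul_left_cancel₀ (by simp) hneg

theorem coeff_jet_mul_pderiv (n : ℕ) (F : DiffPoly I) (m : ℕ →₀ ℕ) :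
    (jet n * pderiv n F).coeff m = m n • F.coeff m := by
  classical
  induction F using MvPolynomial.induction_on' with
  | monomial k a =>
    rw [jet, MvPolynomial.X_mul_pderiv_monomial, MvPolynomial.coeff_smul,
      MvPolynomial.coeff_monomial]
    split_ifs with h
    · rw [h]
    · rw [smul_zero, smul_zero]
  | add F G hF hG => rw [map_add, mul_add, MvPolynomial.coeff_add, hF, hG, MvPolynomial.coeff_add,
      smul_add]

theorem notMem_vars_of_pderiv_eq_zero {F : DiffPoly I} {n : ℕ} (h : pderiv n F = 0) :
    n ∉ F.vars := by
  intro hn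
  obtain ⟨m, hm, hnm⟩ := (MvPolynomial.mem_vars_iff_mem_support n).1 hn
  have hcoeff := coeff_jet_mul_pderiv n F m
  rw [h, mul_zero, MvPolynomial.coeff_zero, ← Nat.cast_smul_eq_nsmul ℝ, eq_comm,
    smul_eq_zero_iff_left (MvPolynomial.mem_support_iff.1 hm), Nat.cast_eq_zero] at hcoeff
  exact Finsupp.mem_support_iff.1 hnm hcoeff

section NullMultiples

variable {Y : DiffPoly I}

theorem varD_fn_mul {s : Finset ℕ} (hs : Y.vars ⊆ s) (f : Smooth I) :
    varD (fn f * Y) = fn (der f) * Y + fn f * partialU Y +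
      ∑ n ∈ s, ((-dx) ^ (n + 1)) (fn f * pderiv n Y) := by
  classical
  have hs' : (fn f * Y).vars ⊆ s := by
    refine (MvPolynomial.vars_mul _ _).trans ?_
    rwa [fn, MvPolynomial.vars_C, Finset.empty_union]
  rw [varD_eq hs', ← partialUDerivation_apply, Derivation.leibniz]
  simp only [partialUDerivation_apply, smul_eq_mul, partialU_fn, Derivation.leibniz, pderiv_fn,
    mul_zero, add_zero]
  ring

theorem pderiv_eq_zero_of_varD_fn_mul (h : ∀ f : Smooth I, varD (fn f * Y) = 0) {n : ℕ}
    (hn : Y.vars ⊆ Finset.range (n + 2)) : pderiv (n + 1) Y = 0 := by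
  refine ext_atPoint fun u => ?_
  have hu := congrArg (atPoint u) (h (Smooth.divPow u (n + 2)))
  rw [varD_fn_mul hn, Finset.sum_range_succ, map_add, map_add, map_add, map_sum,
    Finset.sum_eq_zero (fun k hk => atPoint_neg_dx_pow_divPow_mul_of_lt u
      (Nat.succ_lt_succ (Finset.mem_range.1 hk)) _), atPoint_neg_dx_pow_divPow_mul,
    Smooth.der_divPow_succ, map_mul, map_mul, atPoint_fn, atPoint_fn,
    Smooth.divPow_apply_succ, Smooth.divPow_apply_succ] at hu
  simpa using hu

theorem vars_subset_singleton_of_varD_fn_mul (h : ∀ f : Smooth I, varD (fn f * Y) = 0) :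
    Y.vars ⊆ {0} := by
  obtain ⟨N, hN⟩ := exists_vars_subset_range Y
  have descend (n : ℕ) (hn : Y.vars ⊆ Finset.range (n + 1)) : Y.vars ⊆ {0} := by
    induction n with
    | zero => exact hn
    | succ n ih =>
      refine ih fun i hi => Finset.mem_range.2 ?_
      have hlt := Finset.mem_range.1 (hn hi)
      have hne : i ≠ n + 1 := fun e =>
        notMem_vars_of_pderiv_eq_zero (pderiv_eq_zero_of_varD_fn_mul h hn) (e ▸ hi)
      omega
  exact descend N (hN _ N.le_succ)

theorem eq_jet_mul_pderiv_of_varD_fn_mul (h : ∀ f : Smooth I, varD (fn f * Y) = 0) :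
    Y = jet 0 * pderiv 0 Y := by
  refine ext_atPoint fun u => ?_
  have hu := congrArg (atPoint u) (h (Smooth.divPow u 1))
  rw [varD_fn_mul (vars_subset_singleton_of_varD_fn_mul h), Finset.sum_singleton, map_add, map_add,
    atPoint_neg_dx_pow_divPow_mul, Smooth.der_divPow_succ, map_mul, map_mul, atPoint_fn, atPoint_fn,
    Smooth.divPow_apply_succ, Smooth.divPow_apply_zero] at hu
  rw [map_mul, atPoint_jet, ← sub_eq_zero]
  simpa [sub_eq_add_neg] using hu

theorem eq_zero_of_loc_fn_mul (hY : Y ∈ degGE 2) (h : ∀ f : Smooth I, loc (fn f * Y) = 0) :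
    Y = 0 := by
  have hvarD (f : Smooth I) : varD (fn f * Y) = 0 := varD_eq_zero_of_loc (h f)
  ext1 m
  by_contra hm
  have hsupport : m.support ⊆ {0} := fun i hi => vars_subset_singleton_of_varD_fn_mul hvarD
    ((MvPolynomial.mem_vars_iff_mem_support i).2 ⟨m, MvPolynomial.mem_support_iff.2 hm, hi⟩)
  have hone : m 0 = 1 := by
    have hcoeff := coeff_jet_mul_pderiv 0 Y m
    rw [← eq_jet_mul_pderiv_of_varD_fn_mul hvarD, ← Nat.cast_smul_eq_nsmul ℝ, eq_comm] at hcoeff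
    exact_mod_cast smul_left_injective ℝ hm (hcoeff.trans (one_smul ℝ _).symm)
  have hweight := hY m hm
  rw [Finsupp.support_subset_singleton.1 hsupport, hone, Finsupp.weight_single] at hweight
  simp at hweight

end NullMultiples

/-! ### Differential operators -/

/-- The action of differential operators, bundled as a linear map. -/
def actHom : DiffOp I →ₗ[ℝ] Module.End ℝ (DiffPoly I) :=
  Finsupp.lsum ℝ fun j =>
    LinearMap.lcomp ℝ (DiffPoly I) (dx ^ j) ∘ₗ LinearMap.mul ℝ (DiffPoly I)

theorem act_eq_sum (A : DiffOp I) (F : DiffPoly I) :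
    A.act F = ∑ j ∈ A.support, A j * (dx ^ j) F :=
  Finset.sum_congr rfl fun j _ => congrArg (A j * ·) (iterate_totalD j F)

theorem actHom_apply (A : DiffOp I) (F : DiffPoly I) : actHom A F = A.act F := by
  rw [act_eq_sum, actHom, Finsupp.lsum_apply, Finsupp.sum, LinearMap.sum_apply]
  rfl

theorem act_add_left (A B : DiffOp I) (F : DiffPoly I) : (A + B).act F = A.act F + B.act F := by
  simp only [← actHom_apply, map_add, LinearMap.add_apply]

theorem act_sub_left (A B : DiffOp I) (F : DiffPoly I) : (A - B).act F = A.act F - B.act F := by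
  simp only [← actHom_apply, map_sub, LinearMap.sub_apply]

theorem act_zero_left (F : DiffPoly I) : (0 : DiffOp I).act F = 0 := by
  simp only [← actHom_apply, map_zero, LinearMap.zero_apply]

theorem act_sum_left {ι : Type*} (s : Finset ι) (A : ι → DiffOp I) (F : DiffPoly I) :
    (∑ i ∈ s, A i).act F = ∑ i ∈ s, (A i).act F := by
  simp only [← actHom_apply, map_sum, LinearMap.sum_apply]

theorem act_zero (A : DiffOp I) : A.act 0 = 0 := by rw [← actHom_apply, map_zero]

theorem act_single (j : ℕ) (a F : DiffPoly I) :
    DiffOp.act (Finsupp.single j a) F = a * (dx ^ j) F := by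
  rw [← actHom_apply, actHom, Finsupp.lsum_single]
  rfl

theorem atPoint_act_divPow (u : I) {A : DiffOp I} {k : ℕ} (h : ∀ j, k < j → A j = 0) :
    atPoint u (A.act (fn (Smooth.divPow u k))) = atPoint u (A k) * MvPolynomial.X 0 ^ k := by
  rw [act_eq_sum, map_sum, Finset.sum_eq_single k, map_mul, atPoint_dx_pow_divPow]
  · intro j _ hjk
    rcases hjk.lt_or_gt with hlt | hlt
    · rw [map_mul, atPoint_dx_pow_divPow_of_lt u hlt, mul_zero]
    · rw [h j hlt, zero_mul, map_zero]
  · intro hk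
    rw [Finsupp.notMem_support_iff.1 hk, zero_mul, map_zero]

theorem diffOp_eq_zero {A : DiffOp I} (h : ∀ f, A.act (fn f) = 0) : A = 0 := by
  by_contra hA
  have hne := Finsupp.support_nonempty_iff.2 hA
  refine Finsupp.mem_support_iff.1 (A.support.max'_mem hne) (ext_atPoint fun u => ?_)
  have hu := atPoint_act_divPow u (A := A) (k := A.support.max' hne) fun j hj =>
    Finsupp.notMem_support_iff.1 fun hmem => hj.not_ge (A.support.le_max' j hmem)
  rw [h, map_zero, eq_comm, mul_eq_zero] at hu
  rw [map_zero]
  exact hu.resolve_right (pow_ne_zero _ (MvPolynomial.X_ne_zero 0))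

/-- The maps given by differential operators. -/
def IsDiffOp (T : DiffPoly I → DiffPoly I) : Prop := ∃ A : DiffOp I, ∀ F, T F = A.act F

namespace IsDiffOp

variable {S T : DiffPoly I → DiffPoly I}

theorem act (A : DiffOp I) : IsDiffOp A.act := ⟨A, fun _ => rfl⟩

theorem id : IsDiffOp (fun F : DiffPoly I => F) :=
  ⟨Finsupp.single 0 1, fun F => by simp [act_single]⟩

theorem zero : IsDiffOp fun _ : DiffPoly I => 0 := ⟨0, fun F => (act_zero_left F).symm⟩

theorem add (hS : IsDiffOp S) (hT : IsDiffOp T) : IsDiffOp fun F => S F + T F := by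
  obtain ⟨A, hA⟩ := hS
  obtain ⟨B, hB⟩ := hT
  exact ⟨A + B, fun F => by simp only [act_add_left, hA, hB]⟩

theorem sum {ι : Type*} {s : Finset ι} {T : ι → DiffPoly I → DiffPoly I}
    (h : ∀ i ∈ s, IsDiffOp (T i)) : IsDiffOp fun F => ∑ i ∈ s, T i F := by
  choose! A hA using h
  exact ⟨∑ i ∈ s, A i, fun F =>
    (Finset.sum_congr rfl fun i hi => hA i hi F).trans (act_sum_left s A F).symm⟩

theorem mul_left (a : DiffPoly I) (hT : IsDiffOp T) : IsDiffOp fun F => a * T F := by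
  obtain ⟨A, hA⟩ := hT
  refine ⟨∑ j ∈ A.support, Finsupp.single j (a * A j), fun F => ?_⟩
  simp only [hA, act_sum_left, act_single, act_eq_sum A, Finset.mul_sum, mul_assoc]

theorem mul_right (a : DiffPoly I) (hT : IsDiffOp T) : IsDiffOp fun F => T F * a := by
  simpa only [mul_comm] using hT.mul_left a

theorem dx_comp (hT : IsDiffOp T) : IsDiffOp fun F => dx (T F) := by
  obtain ⟨A, hA⟩ := hT
  refine ⟨∑ j ∈ A.support, (Finsupp.single (j + 1) (A j) + Finsupp.single j (dx (A j))),
    fun F => ?_⟩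
  simp only [hA, act_eq_sum A, map_sum, dx_mul, act_sum_left, act_add_left, act_single, dx_pow_succ,
    mul_comm]

theorem dx_pow_comp (k : ℕ) (hT : IsDiffOp T) : IsDiffOp fun F => (dx ^ k) (T F) := by
  induction k with
  | zero => exact hT
  | succ k ih => simpa only [dx_pow_succ] using ih.dx_comp

theorem neg_dx_pow_comp (k : ℕ) (hT : IsDiffOp T) : IsDiffOp fun F => ((-dx) ^ k) (T F) := by
  simpa only [neg_dx_pow] using (hT.dx_pow_comp k).mul_left _

theorem pr_comp (hT : IsDiffOp T) (F : DiffPoly I) : IsDiffOp fun w => pr (T w) F := by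
  simp only [pr_apply (F := F) subset_rfl]
  exact (hT.mul_right _).add (sum fun n _ => (hT.dx_pow_comp (n + 1)).mul_right _)

theorem eq_zero (hT : IsDiffOp T) (h : ∀ f, T (fn f) = 0) (F : DiffPoly I) : T F = 0 := by
  obtain ⟨A, hA⟩ := hT
  rw [hA, diffOp_eq_zero fun f => (hA _).symm.trans (h f), act_zero_left]

end IsDiffOp

/-- The formal adjoint of a differential operator. -/
def adjoint (A : DiffOp I) (F : DiffPoly I) : DiffPoly I :=
  ∑ j ∈ A.support, ((-dx) ^ j) (A j * F)

theorem loc_mul_act (A : DiffOp I) (a b : DiffPoly I) :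
    loc (a * A.act b) = loc (adjoint A a * b) := by
  simp only [act_eq_sum, adjoint, Finset.mul_sum, Finset.sum_mul, map_sum, ← loc_mul_dx_pow,
    mul_left_comm, mul_assoc]

theorem IsDiffOp.adjoint_comp (A : DiffOp I) {T : DiffPoly I → DiffPoly I} (hT : IsDiffOp T) :
    IsDiffOp fun F => adjoint A (T F) :=
  sum fun j _ => (hT.mul_left _).neg_dx_pow_comp j

/-- The adjoint, in `X`, of the linearization `X ↦ w * pr X F`. -/
def linAdjoint (w F : DiffPoly I) : DiffPoly I :=
  w * partialU F + ∑ n ∈ F.vars, ((-dx) ^ (n + 1)) (w * pderiv n F)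

theorem loc_mul_pr (w X F : DiffPoly I) : loc (w * pr X F) = loc (linAdjoint w F * X) := by
  rw [pr_apply subset_rfl, linAdjoint, mul_add, add_mul, map_add, map_add, mul_assoc,
    mul_comm X]
  simp only [Finset.mul_sum, Finset.sum_mul, map_sum, ← loc_mul_dx_pow]
  simp only [mul_left_comm, mul_comm]

theorem IsDiffOp.linAdjoint_comp {T : DiffPoly I → DiffPoly I} (hT : IsDiffOp T) (F : DiffPoly I) :
    IsDiffOp fun w => linAdjoint (T w) F :=
  (hT.mul_right _).add (sum fun n _ => (hT.mul_right _).neg_dx_pow_comp (n + 1))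

theorem linAdjoint_mem_degGE {d e k : ℕ} (hk : k ≤ d + e) {w F : DiffPoly I} (hw : w ∈ degGE e)
    (hF : F ∈ degGE d) : linAdjoint w F ∈ degGE k := by
  refine add_mem (mul_mem_degGE (by omega) hw (partialU_mem_degGE hF)) (sum_mem fun n _ => ?_)
  exact degGE_anti (by omega)
    (neg_dx_pow_mem_degGE (mul_mem_degGE le_rfl hw (pderiv_mem_degGE hF n)) (n + 1))

/-- Homogeneity of a differential operator, with `∂ₓ` of degree one. -/
def OpHasDegree (A : DiffOp I) (d : ℕ) : Prop :=
  ∀ j, A j ≠ 0 → ∃ e, e + j = d ∧ HasDegree (A j) e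

namespace OpHasDegree

variable {A B : DiffOp I} {d : ℕ}

theorem eq_zero_of_lt (h : OpHasDegree A d) {j : ℕ} (hj : d < j) : A j = 0 := by
  by_contra hne
  obtain ⟨e, he, -⟩ := h j hne
  omega

theorem hasDegree_coeff (h : OpHasDegree A d) (j : ℕ) : HasDegree (A j) (d - j) := by
  by_cases hne : A j = 0
  · rw [hne]
    exact MvPolynomial.isWeightedHomogeneous_zero _ _ _
  · obtain ⟨e, he, hdeg⟩ := h j hne
    rwa [← he, Nat.add_sub_cancel]

theorem coeff_mem_degGE (h : OpHasDegree A d) (j : ℕ) : A j ∈ degGE (d - j) :=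
  (h.hasDegree_coeff j).mem_degGE

theorem act_mem_degGE {e k : ℕ} (h : OpHasDegree A d) (hk : k ≤ d + e) {F : DiffPoly I}
    (hF : F ∈ degGE e) : A.act F ∈ degGE k := by
  rw [act_eq_sum]
  exact sum_mem fun j _ => mul_mem_degGE (by omega) (h.coeff_mem_degGE j) (dx_pow_mem_degGE hF j)

theorem adjoint_mem_degGE {e k : ℕ} (h : OpHasDegree A d) (hk : k ≤ d + e) {F : DiffPoly I}
    (hF : F ∈ degGE e) : adjoint A F ∈ degGE k :=
  sum_mem fun j _ => degGE_anti (by omega)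
    (neg_dx_pow_mem_degGE (mul_mem_degGE le_rfl (h.coeff_mem_degGE j) hF) j)

theorem zero : OpHasDegree (0 : DiffOp I) d := fun _ h => absurd rfl h

theorem single {a : DiffPoly I} {e j : ℕ} (he : e + j = d) (ha : HasDegree a e) :
    OpHasDegree (Finsupp.single j a) d := by
  intro k hk
  obtain rfl : j = k := by
    by_contra hne
    exact hk (Finsupp.single_eq_of_ne' hne)
  rw [Finsupp.single_eq_same]
  exact ⟨e, he, ha⟩

theorem add (hA : OpHasDegree A d) (hB : OpHasDegree B d) : OpHasDegree (A + B) d := by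
  intro j hj
  have hle : j ≤ d := by
    by_contra! hlt
    exact hj (by rw [Finsupp.add_apply, hA.eq_zero_of_lt hlt, hB.eq_zero_of_lt hlt, add_zero])
  exact ⟨d - j, Nat.sub_add_cancel hle, (hA.hasDegree_coeff j).add (hB.hasDegree_coeff j)⟩

theorem sub (hA : OpHasDegree A d) (hB : OpHasDegree B d) : OpHasDegree (A - B) d := by
  intro j hj
  have hle : j ≤ d := by
    by_contra! hlt
    exact hj (by rw [Finsupp.sub_apply, hA.eq_zero_of_lt hlt, hB.eq_zero_of_lt hlt, sub_zero])
  exact ⟨d - j, Nat.sub_add_cancel hle,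
    MvPolynomial.IsWeightedHomogeneous.sub (hA.hasDegree_coeff j) (hB.hasDegree_coeff j)⟩

theorem sum {ι : Type*} {s : Finset ι} {A : ι → DiffOp I} (h : ∀ i ∈ s, OpHasDegree (A i) d) :
    OpHasDegree (∑ i ∈ s, A i) d :=
  Finset.sum_induction _ (OpHasDegree · d) (fun _ _ => add) zero h

end OpHasDegree

theorem sum_ite_sum_ite {ι M : Type*} [Fintype ι] [AddCommMonoid M] (σ : ι → ℕ) (m : ℕ) (n : Fin 6)
    (f : ι → M) :
    (∑ j : Fin 6, if m + (j : ℕ) = n then ∑ y, (if σ y = j then f y else 0) else 0) =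
      ∑ y, if m + σ y = n then f y else 0 := by
  have inner (j : Fin 6) : (if m + (j : ℕ) = n then ∑ y, (if σ y = j then f y else 0) else 0) =
      ∑ y, if m + (j : ℕ) = n ∧ σ y = j then f y else 0 := by
    split_ifs with h <;> simp [h]
  simp only [inner]
  rw [Finset.sum_comm]
  refine Finset.sum_congr rfl fun y _ => ?_
  split_ifs with h
  · rw [Finset.sum_eq_single_of_mem ⟨σ y, by omega⟩ (Finset.mem_univ _), if_pos ⟨h, rfl⟩]
    exact fun j _ hj => if_neg fun hσ => hj (Fin.ext hσ.2.symm)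
  · exact Finset.sum_eq_zero fun j _ => if_neg fun ⟨hj, hσ⟩ => h (hσ ▸ hj)

theorem field_apply (L : Ser (DiffOp I)) (G : Ser (DiffPoly I)) (n : Fin 6) :
    field L G n = ∑ z : Fin 6 × Fin 6,
      if (z.1 : ℕ) + z.2 = n then (L z.1).act (varD (G z.2)) else 0 := by
  rw [Fintype.sum_prod_type]
  rfl

theorem bracket_apply (L : Ser (DiffOp I)) (F G : Ser (DiffPoly I)) (n : Fin 6) :
    bracket L F G n = ∑ y : Fin 6 × Fin 6 × Fin 6, if (y.1 : ℕ) + (y.2.1 + y.2.2) = n then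
      varD (F y.1) * (L y.2.1).act (varD (G y.2.2)) else 0 := by
  rw [Fintype.sum_prod_type, bracket, Ser.conv]
  refine Finset.sum_congr rfl fun i _ => ?_
  rw [← sum_ite_sum_ite (fun z : Fin 6 × Fin 6 => (z.1 : ℕ) + z.2) i n
    fun z => varD (F i) * (L z.1).act (varD (G z.2))]
  simp only [field_apply, Finset.mul_sum, mul_ite, mul_zero]

theorem loc_bracket (L : Ser (DiffOp I)) (F G : Ser (DiffPoly I)) (n : Fin 6) :
    loc (bracket L F G n) = ∑ y : Fin 6 × Fin 6 × Fin 6, if (y.1 : ℕ) + (y.2.1 + y.2.2) = n then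
      loc (varD (F y.1) * (L y.2.1).act (varD (G y.2.2))) else 0 := by
  rw [bracket_apply, map_sum]
  refine Finset.sum_congr rfl fun y _ => ?_
  rw [apply_ite loc, map_zero]

theorem loc_bracket_swap (L : Ser (DiffOp I)) (F G : Ser (DiffPoly I)) (n : Fin 6) :
    loc (bracket L G F n) = ∑ y : Fin 6 × Fin 6 × Fin 6, if (y.1 : ℕ) + (y.2.1 + y.2.2) = n then
      loc (varD (G y.2.2) * (L y.2.1).act (varD (F y.1))) else 0 := by
  rw [loc_bracket]
  refine Fintype.sum_equiv ⟨fun y => (y.2.2, y.2.1, y.1), fun y => (y.2.2, y.2.1, y.1),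
    fun _ => rfl, fun _ => rfl⟩ _ _ fun y => ?_
  refine if_congr ?_ rfl rfl
  simp only [Equiv.coe_fn_mk]
  omega

/-! ### The Jacobi identity -/

/-- The derivative of the coefficients of a differential operator along `X`. -/
def prOp (X : DiffPoly I) (A : DiffOp I) (b : DiffPoly I) : DiffPoly I :=
  ∑ j ∈ A.support, pr X (A j) * (dx ^ j) b

theorem pr_act (X : DiffPoly I) (A : DiffOp I) (b : DiffPoly I) :
    pr X (A.act b) = prOp X A b + A.act (pr X b) := by
  simp only [act_eq_sum, prOp, map_sum, ← Finset.sum_add_distrib]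
  refine Finset.sum_congr rfl fun j _ => ?_
  rw [Derivation.leibniz, pr_dx_pow, smul_eq_mul, smul_eq_mul, add_comm, mul_comm ((dx ^ j) b)]

/-- `T` is a local trilinear form `(a, b, c) ↦ ∫ M(a, b) c dx`, with `M` a bidifferential operator
whose values have degree at least two. -/
def IsLocalForm (T : DiffPoly I → DiffPoly I → DiffPoly I → LocalFunctional I) : Prop :=
  ∃ M : DiffPoly I → DiffPoly I → DiffPoly I, (∀ a b c, T a b c = loc (M a b * c)) ∧
    (∀ a, IsDiffOp (M a)) ∧ (∀ b, IsDiffOp fun a => M a b) ∧ ∀ a b, M a b ∈ degGE 2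

namespace IsLocalForm

variable {S T : DiffPoly I → DiffPoly I → DiffPoly I → LocalFunctional I}

theorem zero : IsLocalForm (I := I) fun _ _ _ => 0 :=
  ⟨fun _ _ => 0, by simp, fun _ => IsDiffOp.zero, fun _ => IsDiffOp.zero, fun _ _ => zero_mem _⟩

theorem add (hS : IsLocalForm S) (hT : IsLocalForm T) :
    IsLocalForm fun a b c => S a b c + T a b c := by
  obtain ⟨M, hM, hM₂, hM₁, hMdeg⟩ := hS
  obtain ⟨N, hN, hN₂, hN₁, hNdeg⟩ := hT
  exact ⟨fun a b => M a b + N a b, fun a b c => by simp only [hM, hN, add_mul, map_add],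
    fun a => (hM₂ a).add (hN₂ a), fun b => (hM₁ b).add (hN₁ b),
    fun a b => add_mem (hMdeg a b) (hNdeg a b)⟩

theorem sum {ι : Type*} {s : Finset ι}
    {T : ι → DiffPoly I → DiffPoly I → DiffPoly I → LocalFunctional I}
    (hT : ∀ i ∈ s, IsLocalForm (T i)) : IsLocalForm fun a b c => ∑ i ∈ s, T i a b c := by
  convert Finset.sum_induction T IsLocalForm (fun _ _ => add) zero hT using 4
  simp only [Finset.sum_apply]

theorem eq_zero (hT : IsLocalForm T) (h : ∀ f g k, T (fn f) (fn g) (fn k) = 0)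
    (a b c : DiffPoly I) : T a b c = 0 := by
  obtain ⟨M, hM, hM₂, hM₁, hdeg⟩ := hT
  have hfn (f g : Smooth I) : M (fn f) (fn g) = 0 :=
    eq_zero_of_loc_fn_mul (hdeg _ _) fun k => by rw [mul_comm, ← hM, h]
  have hzero : M a b = 0 := (hM₁ b).eq_zero (fun f => (hM₂ _).eq_zero (hfn f) b) a
  rw [hM, hzero, zero_mul, map_zero]

end IsLocalForm

/-- The sum of a trilinear form over the cyclic permutations of its arguments. -/
def cyclicSum {α M : Type*} [Add M] (T : α → α → α → M) (a b c : α) : M :=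
  T a b c + T b c a + T c a b

/-- The polarization of the Schouten square `A ↦ [A, A]` of differential operators, evaluated on
`a, b, c`. -/
def trivector (A B : DiffOp I) : DiffPoly I → DiffPoly I → DiffPoly I → LocalFunctional I :=
  cyclicSum fun a b c => loc (a * prOp (A.act c) B b)

section LocalForm

variable {A B : DiffOp I} {m n : ℕ}

theorem isLocalForm_mul_prOp (hA : OpHasDegree A (m + 1)) (hB : OpHasDegree B (n + 1)) :
    IsLocalForm fun a b c => loc (a * prOp (A.act c) B b) := by
  refine ⟨fun a b => ∑ j ∈ B.support, adjoint A (linAdjoint (a * (dx ^ j) b) (B j)),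
    fun a b c => ?_, fun a => ?_, fun b => ?_, fun a b => ?_⟩
  · simp only [prOp, Finset.mul_sum, Finset.sum_mul, map_sum, ← loc_mul_act, ← loc_mul_pr]
    simp only [mul_left_comm, mul_comm]
  · exact .sum fun j _ =>
      (((IsDiffOp.id.dx_pow_comp j).mul_left a).linAdjoint_comp _).adjoint_comp A
  · exact .sum fun j _ => ((IsDiffOp.id.mul_right _).linAdjoint_comp _).adjoint_comp A
  · refine sum_mem fun j _ => hA.adjoint_mem_degGE (e := (n + 1 - j) + j) (by omega) ?_
    exact linAdjoint_mem_degGE le_rfl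
      (mul_mem_degGE (by omega) (mem_degGE_zero a) (dx_pow_mem_degGE (mem_degGE_zero b) j))
      (hB.coeff_mem_degGE j)

theorem pr_act_coeff_mem_degGE (hA : OpHasDegree A (m + 1)) (hB : OpHasDegree B (n + 1))
    (a : DiffPoly I) (j : ℕ) : pr (A.act a) (B j) ∈ degGE ((n + 1 - j) + (m + 1)) :=
  pr_mem_degGE le_rfl (hA.act_mem_degGE le_rfl (mem_degGE_zero a)) (hB.coeff_mem_degGE j)

theorem isLocalForm_mul_prOp_rotate (hA : OpHasDegree A (m + 1)) (hB : OpHasDegree B (n + 1)) :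
    IsLocalForm fun a b c => loc (b * prOp (A.act a) B c) := by
  refine ⟨fun a b => ∑ j ∈ B.support, ((-dx) ^ j) (b * pr (A.act a) (B j)),
    fun a b c => ?_, fun a => ?_, fun b => ?_, fun a b => ?_⟩
  · simp only [prOp, Finset.mul_sum, Finset.sum_mul, map_sum, ← loc_mul_dx_pow, mul_assoc]
  · exact .sum fun j _ => (IsDiffOp.id.mul_right _).neg_dx_pow_comp j
  · exact .sum fun j _ => (((IsDiffOp.act A).pr_comp _).mul_left b).neg_dx_pow_comp j
  · exact sum_mem fun j _ => degGE_anti (by omega)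
      (neg_dx_pow_mem_degGE (Ideal.mul_mem_left _ b (pr_act_coeff_mem_degGE hA hB a j)) j)

theorem isLocalForm_mul_prOp_rotate_rotate (hA : OpHasDegree A (m + 1))
    (hB : OpHasDegree B (n + 1)) : IsLocalForm fun a b c => loc (c * prOp (A.act b) B a) := by
  refine ⟨fun a b => prOp (A.act b) B a, fun a b c => by rw [mul_comm], fun a => ?_, fun b => ?_,
    fun a b => ?_⟩
  · exact .sum fun j _ => ((IsDiffOp.act A).pr_comp _).mul_right _
  · exact .sum fun j _ => (IsDiffOp.id.dx_pow_comp j).mul_left _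
  · exact sum_mem fun j _ => mul_mem_degGE (e := j) (by omega) (pr_act_coeff_mem_degGE hA hB b j)
      (degGE_anti (by omega) (dx_pow_mem_degGE (mem_degGE_zero a) j))

theorem isLocalForm_trivector (hA : OpHasDegree A (m + 1)) (hB : OpHasDegree B (n + 1)) :
    IsLocalForm (trivector A B) :=
  ((isLocalForm_mul_prOp hA hB).add (isLocalForm_mul_prOp_rotate hA hB)).add
    (isLocalForm_mul_prOp_rotate_rotate hA hB)

end LocalForm

/-- Skew-adjointness of a differential operator. -/
def IsSkew (A : DiffOp I) : Prop := ∀ a b, loc (a * A.act b) + loc (b * A.act a) = 0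

/-- The derivative of `∫ a B(b) dx` along the vector field `A(c)`. For `a, b, c` the variational
derivatives of `F, G, H` it is `{{F, G}, H}`, where the inner bracket is given by `B` and the outer
one by `A`. -/
def nestedBracket (A B : DiffOp I) (a b c : DiffPoly I) : LocalFunctional I :=
  loc (pr (A.act c) (a * B.act b))

theorem nestedBracket_eq {A B : DiffOp I} (hB : IsSkew B) (a b c : DiffPoly I) :
    nestedBracket A B a b c = loc (pr (A.act c) a * B.act b)
      - loc (pr (A.act c) b * B.act a) + loc (a * prOp (A.act c) B b) := by
  rw [nestedBracket, Derivation.leibniz, pr_act, smul_eq_mul, smul_eq_mul, mul_add, map_add,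
    map_add, eq_neg_of_add_eq_zero_left (hB a _), mul_comm (B.act b)]
  abel

/-- The second derivatives of the functionals cancel, being self-adjoint. -/
theorem cyclicSum_nestedBracket_symm {A B : DiffOp I} (hA : IsSkew A) (hB : IsSkew B)
    (F G H : DiffPoly I) :
    cyclicSum (nestedBracket A B) (varD F) (varD G) (varD H) +
        cyclicSum (nestedBracket B A) (varD F) (varD G) (varD H) =
      trivector A B (varD F) (varD G) (varD H) + trivector B A (varD F) (varD G) (varD H) := by
  simp only [cyclicSum, nestedBracket_eq hA, nestedBracket_eq hB, trivector]
  rw [loc_pr_varD_mul_comm F (A.act (varD H)), loc_pr_varD_mul_comm G (A.act (varD H)),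
    loc_pr_varD_mul_comm G (A.act (varD F)), loc_pr_varD_mul_comm H (A.act (varD F)),
    loc_pr_varD_mul_comm H (A.act (varD G)), loc_pr_varD_mul_comm F (A.act (varD G))]
  abel

theorem loc_pr_bracket (X : DiffPoly I) (L : Ser (DiffOp I)) (F G : Ser (DiffPoly I)) (n : Fin 6) :
    loc (pr X (bracket L F G n)) =
      ∑ y : Fin 6 × Fin 6 × Fin 6, if (y.1 : ℕ) + (y.2.1 + y.2.2) = n then
        loc (pr X (varD (F y.1) * (L y.2.1).act (varD (G y.2.2)))) else 0 := by
  rw [bracket_apply, map_sum, map_sum]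
  refine Finset.sum_congr rfl fun y _ => ?_
  rw [apply_ite (pr X), apply_ite loc, map_zero, map_zero]

theorem loc_bracket_bracket (L : Ser (DiffOp I)) (F G H : Ser (DiffPoly I)) (n : Fin 6) :
    loc (bracket L (bracket L F G) H n) = ∑ w : Fin 6 × Fin 6, ∑ v : Fin 6 × Fin 6 × Fin 6,
      if (w.1 : ℕ) + w.2 + (v.1 + v.2.1 + v.2.2) = n then
        nestedBracket (L w.1) (L w.2) (varD (F v.1)) (varD (G v.2.1)) (varD (H v.2.2)) else 0 := by
  have outer : loc (bracket L (bracket L F G) H n) = ∑ z : Fin 6 × Fin 6, ∑ i : Fin 6,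
      if (z.1 + z.2 : ℕ) + i = n then
        loc (pr ((L z.1).act (varD (H z.2))) (bracket L F G i)) else 0 := by
    rw [loc_bracket, Fintype.sum_prod_type, Finset.sum_comm]
    simp only [loc_varD_mul, add_comm]
  simp only [outer, loc_pr_bracket,
    sum_ite_sum_ite fun y : Fin 6 × Fin 6 × Fin 6 => (y.1 : ℕ) + (y.2.1 + y.2.2)]
  rw [← Fintype.sum_prod_type', ← Fintype.sum_prod_type']
  refine Fintype.sum_equiv ⟨fun x => ((x.1.1, x.2.2.1), (x.2.1, x.2.2.2, x.1.2)),
    fun x => ((x.1.1, x.2.2.2), (x.2.1, x.1.2, x.2.2.1)), fun _ => rfl, fun _ => rfl⟩ _ _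
    fun x => ?_
  refine if_congr ?_ rfl rfl
  simp only [Equiv.coe_fn_mk]
  omega

/-- The coefficient of `ε^m` in `T(L, L)`, for `T` bilinear and `L` a series. -/
def pairSum (T : DiffOp I → DiffOp I → LocalFunctional I) (L : Ser (DiffOp I)) (m : ℕ) :
    LocalFunctional I :=
  ∑ w : Fin 6 × Fin 6, if (w.1 : ℕ) + w.2 = m then T (L w.1) (L w.2) else 0

section PairSum

variable {S T : DiffOp I → DiffOp I → LocalFunctional I} {L : Ser (DiffOp I)}

theorem pairSum_add (m : ℕ) :
    pairSum (fun A B => S A B + T A B) L m = pairSum S L m + pairSum T L m := by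
  simp only [pairSum, ← Finset.sum_add_distrib]
  refine Finset.sum_congr rfl fun w _ => ?_
  split_ifs
  · rfl
  · rw [add_zero]

theorem pairSum_add_self (m : ℕ) :
    pairSum T L m + pairSum T L m = pairSum (fun A B => T A B + T B A) L m := by
  rw [pairSum_add]
  congr 1
  refine Fintype.sum_equiv (Equiv.prodComm _ _) _ _ fun w => ?_
  refine if_congr ?_ rfl rfl
  rw [Equiv.prodComm_apply, Prod.fst_swap, Prod.snd_swap, add_comm]

theorem pairSum_congr
    (h : ∀ i j, S (L i) (L j) + S (L j) (L i) = T (L i) (L j) + T (L j) (L i)) (m : ℕ) :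
    pairSum S L m = pairSum T L m := by
  refine smul_right_injective _ (two_ne_zero (α := ℝ)) ?_
  simp only [two_smul, pairSum_add_self]
  simp only [pairSum, h]

theorem sum_ite_add_eq_pairSum (T : DiffOp I → DiffOp I → LocalFunctional I) (L : Ser (DiffOp I))
    (k n : ℕ) :
    (∑ w : Fin 6 × Fin 6, if (w.1 : ℕ) + w.2 + k = n then T (L w.1) (L w.2) else 0) =
      if k ≤ n then pairSum T L (n - k) else 0 := by
  split_ifs
  · refine Finset.sum_congr rfl fun w _ => ?_
    refine if_congr ?_ rfl rfl
    omega
  · refine Finset.sum_eq_zero fun w _ => if_neg ?_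
    omega

end PairSum

theorem loc_bracket_bracket_eq_pairSum (L : Ser (DiffOp I)) (F G H : Ser (DiffPoly I))
    (n : Fin 6) :
    loc (bracket L (bracket L F G) H n) = ∑ v : Fin 6 × Fin 6 × Fin 6,
      if (v.1 + v.2.1 + v.2.2 : ℕ) ≤ n then
        pairSum (fun A B => nestedBracket A B (varD (F v.1)) (varD (G v.2.1)) (varD (H v.2.2))) L
          (n - (v.1 + v.2.1 + v.2.2)) else 0 := by
  rw [loc_bracket_bracket, Finset.sum_comm]
  exact Finset.sum_congr rfl fun v _ => sum_ite_add_eq_pairSum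
    (fun A B => nestedBracket A B (varD (F v.1)) (varD (G v.2.1)) (varD (H v.2.2))) L _ _

theorem sum_rotate {M : Type*} [AddCommMonoid M] (f : Fin 6 × Fin 6 × Fin 6 → M) :
    ∑ v, f v = ∑ v : Fin 6 × Fin 6 × Fin 6, f (v.2.1, v.2.2, v.1) :=
  Fintype.sum_equiv ⟨fun v => (v.2.2, v.1, v.2.1), fun v => (v.2.1, v.2.2, v.1),
    fun _ => rfl, fun _ => rfl⟩ _ _ fun _ => rfl

theorem loc_jacobi {L : Ser (DiffOp I)} (hL : ∀ n, IsSkew (L n)) (F G H : Ser (DiffPoly I))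
    (n : Fin 6) :
    loc ((bracket L (bracket L F G) H + bracket L (bracket L G H) F
      + bracket L (bracket L H F) G) n) =
    ∑ v : Fin 6 × Fin 6 × Fin 6, if (v.1 + v.2.1 + v.2.2 : ℕ) ≤ n then
      pairSum (fun A B => trivector A B (varD (F v.1)) (varD (G v.2.1)) (varD (H v.2.2))) L
        (n - (v.1 + v.2.1 + v.2.2)) else 0 := by
  let f (F G H : Ser (DiffPoly I)) (v : Fin 6 × Fin 6 × Fin 6) : LocalFunctional I :=
    if (v.1 + v.2.1 + v.2.2 : ℕ) ≤ n then
      pairSum (fun A B => nestedBracket A B (varD (F v.1)) (varD (G v.2.1)) (varD (H v.2.2))) L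
        (n - (v.1 + v.2.1 + v.2.2)) else 0
  have nested (F G H : Ser (DiffPoly I)) :
      loc (bracket L (bracket L F G) H n) = ∑ v, f F G H v :=
    loc_bracket_bracket_eq_pairSum L F G H n
  rw [Pi.add_apply, Pi.add_apply, map_add, map_add, nested, nested, nested,
    sum_rotate (f G H F), sum_rotate (f H F G), sum_rotate fun v => f H F G (v.2.1, v.2.2, v.1),
    ← Finset.sum_add_distrib, ← Finset.sum_add_distrib]
  refine Finset.sum_congr rfl fun v _ => ?_
  have hG : (v.2.1 + v.2.2 + v.1 : ℕ) = v.1 + v.2.1 + v.2.2 := by omega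
  have hH : (v.2.2 + v.1 + v.2.1 : ℕ) = v.1 + v.2.1 + v.2.2 := by omega
  simp only [f, hG, hH]
  split_ifs
  · rw [← pairSum_add, ← pairSum_add]
    exact pairSum_congr (fun i j => cyclicSum_nestedBracket_symm (hL i) (hL j) _ _ _) _
  · rw [add_zero, add_zero]

theorem bracket_eq_zero_of_isNull_left {F : Ser (DiffPoly I)} (hF : IsNull F) (L : Ser (DiffOp I))
    (G : Ser (DiffPoly I)) : bracket L F G = 0 := by
  funext n
  rw [bracket_apply]
  refine Finset.sum_eq_zero fun y _ => ?_
  rw [varD_eq_zero_of_loc (isNull_iff_loc.1 hF y.1), zero_mul, ite_self]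

section Commuting

variable {L : Ser (DiffOp I)} {H : Smooth I → Ser (DiffPoly I)}

theorem isLocalForm_pairSum_trivector (hdeg : ∀ n : Fin 6, OpHasDegree (L n) (n + 1)) (m : ℕ) :
    IsLocalForm fun a b c => pairSum (fun A B => trivector A B a b c) L m := by
  refine .sum (T := fun (w : Fin 6 × Fin 6) a b c =>
    if (w.1 : ℕ) + w.2 = m then trivector (L w.1) (L w.2) a b c else 0) fun w _ => ?_
  split_ifs
  · exact isLocalForm_trivector (hdeg _) (hdeg _)
  · exact .zero

theorem pairSum_trivector_eq_zero (hI : IsConnected (I : Set ℝ)) (hskew : ∀ n, IsSkew (L n))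
    (hdeg : ∀ n : Fin 6, OpHasDegree (L n) (n + 1)) (hH : ∀ f, H f 0 = fn f)
    (hcomm : ∀ f g, IsNull (bracket L (H f) (H g))) {m : ℕ} (hm : m < 6) (a b c : DiffPoly I) :
    pairSum (fun A B => trivector A B a b c) L m = 0 := by
  induction m using Nat.strong_induction_on generalizing a b c with
  | _ m ih =>
  refine (isLocalForm_pairSum_trivector hdeg m).eq_zero (fun f' g' k' => ?_) a b c
  obtain ⟨f, rfl⟩ := Smooth.exists_der_eq hI f'
  obtain ⟨g, rfl⟩ := Smooth.exists_der_eq hI g'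
  obtain ⟨k, rfl⟩ := Smooth.exists_der_eq hI k'
  have hjacobi := loc_jacobi hskew (H f) (H g) (H k) ⟨m, hm⟩
  rw [bracket_eq_zero_of_isNull_left (hcomm f g), bracket_eq_zero_of_isNull_left (hcomm g k),
    bracket_eq_zero_of_isNull_left (hcomm k f), Finset.sum_eq_single_of_mem 0 (Finset.mem_univ _)]
    at hjacobi
  · simpa [hH, varD_fn] using hjacobi.symm
  · intro v _ hv
    have hpos : 0 < (v.1 + v.2.1 + v.2.2 : ℕ) := by
      by_contra! hle
      exact hv (Prod.ext (Fin.ext (by simp; omega))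
        (Prod.ext (Fin.ext (by simp; omega)) (Fin.ext (by simp; omega))))
    split_ifs with hle
    · exact ih _ (by dsimp only at hle ⊢; omega) (by dsimp only; omega) _ _ _
    · rfl

theorem isPoisson_of_commute (hI : IsConnected (I : Set ℝ)) (hskew : ∀ n, IsSkew (L n))
    (hdeg : ∀ n : Fin 6, OpHasDegree (L n) (n + 1)) (hH : ∀ f, H f 0 = fn f)
    (hcomm : ∀ f g, IsNull (bracket L (H f) (H g))) : IsPoisson L where
  antisymm F G := isNull_iff_loc.2 fun n => by
    rw [Pi.add_apply, map_add, loc_bracket, loc_bracket_swap, ← Finset.sum_add_distrib]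
    refine Finset.sum_eq_zero fun y _ => ?_
    split_ifs
    · exact hskew _ _ _
    · exact add_zero 0
  jacobi F G K := isNull_iff_loc.2 fun n => by
    rw [loc_jacobi hskew]
    refine Finset.sum_eq_zero fun v _ => ?_
    split_ifs
    · exact pairSum_trivector_eq_zero hI hskew hdeg hH hcomm (by omega) _ _ _
    · rfl

end Commuting

/-! ### Uniqueness of flows and brackets -/

theorem conv_flip {R S T : Type} [AddCommMonoid T] (m : R → S → T) (a : Ser R) (b : Ser S) :
    Ser.conv m a b = Ser.conv (flip m) b a := by
  funext n
  rw [Ser.conv, Finset.sum_comm]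
  simp only [Ser.conv, flip, add_comm]

theorem conv_sub_conv_of_eq {R S T : Type} [AddCommGroup T] (m : R → S → T) (a : Ser R)
    {b b' : Ser S} {n : Fin 6} (h : ∀ k < n, b k = b' k) :
    Ser.conv m a b n - Ser.conv m a b' n = m (a 0) (b n) - m (a 0) (b' n) := by
  rw [Ser.conv, Ser.conv, ← Finset.sum_sub_distrib,
    Finset.sum_eq_single_of_mem 0 (Finset.mem_univ _), ← Finset.sum_sub_distrib,
    Finset.sum_eq_single_of_mem n (Finset.mem_univ _)]
  · simp only [Fin.val_zero, zero_add, if_true]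
  · intro j _ hj
    rw [if_neg (by simpa [Fin.ext_iff] using hj), if_neg (by simpa [Fin.ext_iff] using hj),
      sub_self]
  · intro i _ hi
    rw [← Finset.sum_sub_distrib]
    refine Finset.sum_eq_zero fun j _ => ?_
    split_ifs with hij
    · rw [h j (Fin.lt_def.2 (by have := Fin.pos_iff_ne_zero.2 hi; omega)), sub_self]
    · exact sub_self 0

theorem field_sub_field_of_eq {L M : Ser (DiffOp I)} {n : Fin 6} (h : ∀ k < n, L k = M k)
    (G : Ser (DiffPoly I)) : field L G n - field M G n = (L n - M n).act (varD (G 0)) := by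
  rw [field, field, conv_flip, conv_flip _ M, conv_sub_conv_of_eq _ _ h, act_sub_left]
  rfl

theorem field_apply_zero (L : Ser (DiffOp I)) (G : Ser (DiffPoly I)) :
    field L G 0 = (L 0).act (varD (G 0)) := by
  simpa [field_apply, act_zero_left] using
    field_sub_field_of_eq (L := L) (M := 0) (n := 0) (fun k hk => absurd hk (Fin.not_lt_zero k)) G

theorem field_mem_degGE {L : Ser (DiffOp I)} (hL : ∀ n : Fin 6, OpHasDegree (L n) (n + 1))
    {G : Ser (DiffPoly I)} (hG : ∀ i : Fin 6, varD (G i) ∈ degGE (i : ℕ)) (n : Fin 6) :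
    field L G n ∈ degGE (n + 1) := by
  rw [field_apply]
  refine sum_mem fun z _ => ?_
  split_ifs with h
  · exact (hL _).act_mem_degGE (by omega) (hG _)
  · exact zero_mem _

section Uniqueness

variable {L M : Ser (DiffOp I)} {H : Smooth I → Ser (DiffPoly I)}

theorem field_eq_of_commute (hI : IsConnected (I : Set ℝ))
    (hL : ∀ n : Fin 6, OpHasDegree (L n) (n + 1)) (hM : ∀ n : Fin 6, OpHasDegree (M n) (n + 1))
    (hH : ∀ f, H f 0 = fn f) {F G : Ser (DiffPoly I)}
    (hF : ∀ i : Fin 6, varD (F i) ∈ degGE (i : ℕ)) (hG : ∀ i : Fin 6, varD (G i) ∈ degGE (i : ℕ))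
    (hLF : ∀ h, IsNull (bracket L (H h) F)) (hMG : ∀ h, IsNull (bracket M (H h) G))
    (hzero : field L F 0 = field M G 0) : field L F = field M G := by
  funext n
  induction n using WellFoundedLT.induction with
  | ind n ih =>
  rcases eq_or_ne n 0 with rfl | hn
  · exact hzero
  have hpos : 0 < (n : ℕ) := Fin.pos_iff_ne_zero.2 hn
  refine sub_eq_zero.1 (eq_zero_of_loc_fn_mul (sub_mem
    (degGE_anti (by omega) (field_mem_degGE hL hF n))
    (degGE_anti (by omega) (field_mem_degGE hM hG n))) fun h' => ?_)
  obtain ⟨h, rfl⟩ := Smooth.exists_der_eq hI h'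
  have hsub : bracket L (H h) F n - bracket M (H h) G n =
      varD (H h 0) * field L F n - varD (H h 0) * field M G n :=
    conv_sub_conv_of_eq (· * ·) (fun i => varD (H h i)) ih
  rw [mul_sub, ← varD_fn, ← hH, ← hsub, map_sub, isNull_iff_loc.1 (hLF h), isNull_iff_loc.1 (hMG h),
    sub_zero]

theorem apply_eq_of_field_eq (hI : IsConnected (I : Set ℝ)) (hH : ∀ f, H f 0 = fn f) {n : Fin 6}
    (h : ∀ k ≤ n, ∀ g, field L (H g) k = field M (H g) k) : L n = M n := by
  induction n using WellFoundedLT.induction with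
  | ind n ih =>
  refine sub_eq_zero.1 (diffOp_eq_zero fun g' => ?_)
  obtain ⟨g, rfl⟩ := Smooth.exists_der_eq hI g'
  rw [← varD_fn, ← hH,
    ← field_sub_field_of_eq (fun k hk => ih k hk fun j hj => h j (hj.trans hk.le)),
    h n le_rfl, sub_self]

end Uniqueness

/-! ### The Hamiltonians -/

theorem fn_add (f g : Smooth I) : fn (f + g) = fn f + fn g := map_add _ f g

theorem fn_sub (f g : Smooth I) : fn (f - g) = fn f - fn g := map_sub _ f g

theorem fn_algebraMap (r : ℝ) : fn (algebraMap ℝ (Smooth I) r) = r • 1 :=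
  Algebra.algebraMap_eq_smul_one r

theorem fn_smul (r : ℝ) (f : Smooth I) : fn (r • f) = r • fn f := by
  rw [Algebra.smul_def, fn, map_mul, Algebra.smul_def]
  rfl

theorem dx_smul (r : ℝ) (F : DiffPoly I) : dx (r • F) = r • dx F := map_smul dx r F

/-- The value of a differential polynomial at the jet `(u, x 0, x 1, …)`. -/
def evalJet (u : I) (x : ℕ → ℝ) : DiffPoly I →+* ℝ := (MvPolynomial.eval x).comp (atPoint u)

@[simp] theorem evalJet_fn (u : I) (x : ℕ → ℝ) (f : Smooth I) : evalJet u x (fn f) = f u := by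
  rw [evalJet, RingHom.comp_apply, atPoint_fn, MvPolynomial.eval_C]

@[simp] theorem evalJet_jet (u : I) (x : ℕ → ℝ) (n : ℕ) : evalJet u x (jet n) = x n := by
  rw [evalJet, RingHom.comp_apply, atPoint_jet, MvPolynomial.eval_X]

@[simp] theorem evalJet_smul (u : I) (x : ℕ → ℝ) (r : ℝ) (F : DiffPoly I) :
    evalJet u x (r • F) = r * evalJet u x F := by
  rw [← one_mul F, ← smul_mul_assoc, ← fn_algebraMap, map_mul, evalJet_fn, Smooth.algebraMap_apply]
  simp

theorem ext_evalJet {F G : DiffPoly I} (h : ∀ u x, evalJet u x F = evalJet u x G) : F = G :=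
  ext_atPoint fun u => MvPolynomial.funext (h u)

theorem varD_fn_mul_jet_pow (f : Smooth I) (n k : ℕ) : varD (fn f * jet n ^ k) =
    fn (der f) * jet n ^ k + (k : ℝ) • ((-dx) ^ (n + 1)) (fn f * jet n ^ (k - 1)) := by
  have hvars : (fn f * jet n ^ k : DiffPoly I).vars ⊆ {n} := by
    intro i hi
    by_contra hn
    refine notMem_vars_of_pderiv_eq_zero ?_ hi
    rw [Derivation.leibniz, Derivation.leibniz_pow, pderiv_fn, pderiv_jet,
      if_neg fun h => hn (Finset.mem_singleton.2 h.symm), smul_zero, smul_zero, smul_zero,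
      smul_zero, add_zero]
  have hpartialU : partialU (fn f * jet n ^ k) = fn (der f) * jet n ^ k := by
    rw [← partialUDerivation_apply, Derivation.leibniz, Derivation.leibniz_pow,
      partialUDerivation_apply, partialUDerivation_apply, partialU_fn, partialU_jet]
    simp only [smul_eq_mul, smul_zero, mul_zero, zero_add, mul_comm]
  have hpderiv : pderiv n (fn f * jet n ^ k) = (k : ℝ) • (fn f * jet n ^ (k - 1)) := by
    rw [Derivation.leibniz, Derivation.leibniz_pow, pderiv_fn, pderiv_jet, if_pos rfl]
    simp only [smul_eq_mul, mul_zero, add_zero, mul_one, ← Nat.cast_smul_eq_nsmul ℝ, mul_smul_comm]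
  rw [varD_eq hvars, Finset.sum_singleton, hpartialU, hpderiv, map_smul]

/-- The variational derivative of `-a u_x²`. -/
def gradTwo (a : Smooth I) : DiffPoly I := fn (der a) * jet 0 ^ 2 + (2 : ℝ) • (fn a * jet 1)

/-- The variational derivative of `P u_xx² - R u_x⁴`. -/
def gradFour (P R : Smooth I) : DiffPoly I :=
  fn (der P) * ((3 : ℝ) • jet 1 ^ 2 + (4 : ℝ) • (jet 0 * jet 2)) + (2 : ℝ) • (fn P * jet 3)
    + (2 : ℝ) • (fn (der (der P)) * (jet 0 ^ 2 * jet 1))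
    + (3 : ℝ) • (fn (der R) * jet 0 ^ 4) + (12 : ℝ) • (fn R * (jet 0 ^ 2 * jet 1))

theorem varD_neg (F : DiffPoly I) : varD (-F) = -varD F := by
  refine eq_neg_of_add_eq_zero_left ?_
  rw [← varD_add, neg_add_cancel, varD_zero]

theorem varD_quadratic (a : Smooth I) : varD (-fn a * jet 0 ^ 2) = gradTwo a := by
  rw [neg_mul, varD_neg, varD_fn_mul_jet_pow]
  refine ext_evalJet fun u x => ?_
  simp only [gradTwo, Nat.cast_ofNat, Nat.add_one_sub_one, zero_add, pow_one, LinearMap.neg_apply,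
    dx_mul, dx_jet, dx_fn, smul_add, smul_neg, neg_add_rev, neg_neg, map_add, map_mul, map_neg,
    map_pow, evalJet_fn, evalJet_jet, evalJet_smul]
  ring

theorem varD_quartic (P R : Smooth I) :
    varD (fn P * jet 1 ^ 2 - fn R * jet 0 ^ 4) = gradFour P R := by
  rw [sub_eq_add_neg, varD_add, varD_neg, varD_fn_mul_jet_pow, varD_fn_mul_jet_pow]
  refine ext_evalJet fun u x => ?_
  simp only [gradFour, Nat.cast_ofNat, Nat.reduceAdd, Nat.add_one_sub_one, zero_add, one_mul,
    pow_succ, pow_zero, Module.End.mul_apply, LinearMap.neg_apply, dx_mul, dx_jet, dx_fn, smul_add,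
    smul_neg, neg_add_rev, neg_neg, map_add, map_mul, map_neg, evalJet_fn, evalJet_jet,
    evalJet_smul]
  ring

theorem HasDegree.smul {F : DiffPoly I} {d : ℕ} (h : HasDegree F d) (r : ℝ) :
    HasDegree (r • F) d := by
  rw [Algebra.smul_def]
  exact h.C_mul (algebraMap ℝ (Smooth I) r)

theorem HasDegree.fn_mul {F : DiffPoly I} {d : ℕ} (hF : HasDegree F d) (f : Smooth I) :
    HasDegree (fn f * F) d := hF.C_mul f

theorem hasDegree_gradTwo (a : Smooth I) : HasDegree (gradTwo a) 2 :=
  (HasDegree.fn_mul ((hasDegree_jet 0).pow 2) _).add (((hasDegree_jet 1).fn_mul _).smul 2)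

theorem hasDegree_gradFour (P R : Smooth I) : HasDegree (gradFour P R) 4 := by
  have h₁₁₂ : HasDegree (jet 0 ^ 2 * jet 1 : DiffPoly I) 4 :=
    ((hasDegree_jet 0).pow 2).mul (hasDegree_jet 1)
  have h₁₁₁₁ : HasDegree (jet 0 ^ 4 : DiffPoly I) 4 := (hasDegree_jet 0).pow 4
  have h₂₂ : HasDegree (jet 1 ^ 2 : DiffPoly I) 4 := (hasDegree_jet 1).pow 2
  have h₁₃ : HasDegree (jet 0 * jet 2 : DiffPoly I) 4 := (hasDegree_jet 0).mul (hasDegree_jet 2)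
  have h₄ : HasDegree (jet 3 : DiffPoly I) 4 := hasDegree_jet 3
  exact ((((HasDegree.fn_mul ((h₂₂.smul 3).add (h₁₃.smul 4)) _).add ((h₄.fn_mul _).smul 2)).add
    ((h₁₁₂.fn_mul _).smul 2)).add ((h₁₁₁₁.fn_mul _).smul 3)).add ((h₁₁₂.fn_mul _).smul 12)

/-- The coefficient of `-ε² u_x²` in `h_f`, in terms of `t = f'''`. -/
def hamA (c t : Smooth I) : Smooth I := (1 / 24 : ℝ) • (c * t)

/-- The coefficient of `ε⁴ u_xx²` in `h_f`, in terms of `t = f'''`. -/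
def hamP (c p t : Smooth I) : Smooth I := p * t + (1 / 480 : ℝ) • (c ^ 2 * der t)

/-- The coefficient of `-ε⁴ u_x⁴` in `h_f`, in terms of `t = f'''`. -/
def hamR (c p s t : Smooth I) : Smooth I :=
  (1 / 1152 : ℝ) • (c * der (der c) * der t) + (1 / 1152 : ℝ) • (c * der c * der (der t))
    + (1 / 3456 : ℝ) • (c ^ 2 * der (der (der t))) + (1 / 6 : ℝ) • (der p * der t)
    + (1 / 6 : ℝ) • (p * der (der t)) - s * t

/-- The variational derivative of `H_f`, in terms of `g = f'`. -/
def hamGrad (c p s g : Smooth I) : Ser (DiffPoly I) :=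
  ![fn g, 0, gradTwo (hamA c (der (der g))), 0,
    gradFour (hamP c p (der (der g))) (hamR c p s (der (der g))), 0]

theorem varD_ham (c p s f : Smooth I) (n : Fin 6) :
    varD (ham c p s f n) = hamGrad c p s (der f) n := by
  fin_cases n
  exacts [varD_fn f, varD_zero, varD_quadratic _, varD_zero, varD_quartic _ _, varD_zero]

theorem hasDegree_hamGrad (c p s g : Smooth I) (n : Fin 6) :
    HasDegree (hamGrad c p s g n) n := by
  have zero (d : ℕ) : HasDegree (0 : DiffPoly I) d := MvPolynomial.isWeightedHomogeneous_zero _ _ _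
  fin_cases n
  exacts [hasDegree_fn g, zero 1, hasDegree_gradTwo _, zero 3, hasDegree_gradFour _ _, zero 5]

theorem varD_ham_mem_degGE (c p s f : Smooth I) (n : Fin 6) :
    varD (ham c p s f n) ∈ degGE (n : ℕ) := by
  rw [varD_ham]
  exact (hasDegree_hamGrad c p s _ n).mem_degGE

/-! ### The second bracket -/

/-- The skew-adjoint first-order operator `a ∂ₓ + ½ (∂ₓ a)`. -/
def skewOp : DiffPoly I →ₗ[ℝ] DiffOp I :=
  Finsupp.lsingle 1 + Finsupp.lsingle 0 ∘ₗ ((1 / 2 : ℝ) • dx)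

theorem skewOp_apply (a : DiffPoly I) :
    skewOp a = Finsupp.single 1 a + Finsupp.single 0 ((1 / 2 : ℝ) • dx a) := rfl

theorem skewOp_act (a F : DiffPoly I) :
    (skewOp a).act F = a * dx F + (1 / 2 : ℝ) • (dx a * F) := by
  rw [skewOp_apply, act_add_left, act_single, act_single, pow_one, pow_zero, Module.End.one_apply,
    smul_mul_assoc]

theorem secondOp_eq_skewOp (q : Smooth I) : secondOp q = skewOp (fn q) := by
  rw [secondOp, skewOp_apply, dx_fn, fn_smul, smul_mul_assoc]

theorem isSkew_skewOp (a : DiffPoly I) : IsSkew (skewOp a) := by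
  intro F G
  have hdx : F * (skewOp a).act G + G * (skewOp a).act F = dx (a * (F * G)) := by
    refine ext_evalJet fun u x => ?_
    simp only [skewOp_act, dx_mul, map_add, map_mul, evalJet_smul]
    ring
  rw [← map_add, hdx, loc_dx]

theorem opHasDegree_skewOp {a : DiffPoly I} {d : ℕ} (ha : HasDegree a d) :
    OpHasDegree (skewOp a) (d + 1) :=
  (OpHasDegree.single rfl ha).add (.single (add_zero _) (ha.dx.smul _))

/-- The operator `∂ₓ ∘ A ∘ ∂ₓ`. -/
def sandwich : DiffOp I →ₗ[ℝ] DiffOp I :=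
  Finsupp.lsum ℝ fun j => Finsupp.lsingle (j + 2) + Finsupp.lsingle (j + 1) ∘ₗ dx

theorem sandwich_eq_sum (A : DiffOp I) : sandwich A =
    ∑ j ∈ A.support, (Finsupp.single (j + 2) (A j) + Finsupp.single (j + 1) (dx (A j))) := rfl

theorem sandwich_act (A : DiffOp I) (F : DiffPoly I) :
    (sandwich A).act F = dx (A.act (dx F)) := by
  rw [sandwich_eq_sum, act_sum_left, act_eq_sum, map_sum]
  refine Finset.sum_congr rfl fun j _ => ?_
  rw [act_add_left, act_single, act_single, dx_mul, ← dx_pow_succ, pow_succ dx (j + 1),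
    pow_succ dx j]
  simp only [Module.End.mul_apply, mul_comm]

theorem IsSkew.sandwich {A : DiffOp I} (hA : IsSkew A) : IsSkew (sandwich A) := by
  intro a b
  rw [sandwich_act, sandwich_act, loc_mul_dx, loc_mul_dx, ← neg_add, hA, neg_zero]

theorem OpHasDegree.sandwich {A : DiffOp I} {d : ℕ} (hA : OpHasDegree A d) :
    OpHasDegree (sandwich A) (d + 2) := by
  rw [sandwich_eq_sum]
  refine OpHasDegree.sum fun j hj => ?_
  obtain ⟨e, he, hdeg⟩ := hA j (Finsupp.mem_support_iff.1 hj)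
  exact (OpHasDegree.single (by omega) hdeg).add (.single (by omega) hdeg.dx)

theorem IsSkew.add {A B : DiffOp I} (hA : IsSkew A) (hB : IsSkew B) : IsSkew (A + B) := by
  intro a b
  have h := congrArg₂ (· + ·) (hA a b) (hB a b)
  simp only [act_add_left, mul_add, map_add]
  rw [add_add_add_comm, h, add_zero]

/-- The order `ε²` of the second bracket.  With `Q' = q`, the flow of `H_u` for the second bracket
must be the flow of `½ H_Q` for the first one; this accounts for the first summand. -/
def opTwo (c q : Smooth I) : DiffOp I :=
  skewOp (gradTwo (hamA c (der (der q)))) + sandwich (skewOp (fn ((1 / 8 : ℝ) • (c * der q))))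

/-- The order `ε⁴` of the second bracket. -/
def opFour (c p s q : Smooth I) : DiffOp I :=
  skewOp (gradFour (hamP c p (der (der q))) (hamR c p s (der (der q))))
    + sandwich (skewOp (fn ((5 / 384 : ℝ) • (c * der c * der (der (der q)))
          + (1 / 96 : ℝ) • (c * der (der c) * der (der q))
          + (1 / 192 : ℝ) • (c ^ 2 * der (der (der (der q))))
          + (5 / 2 : ℝ) • (p * der (der (der q))) + (2 : ℝ) • (der p * der (der q))
          - (9 : ℝ) • (s * der q)) * jet 0 ^ 2
        + fn ((29 / 1920 : ℝ) • (c * der c * der (der q))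
          - (1 / 384 : ℝ) • ((c * der (der c) + der c ^ 2) * der q)
          + (5 / 384 : ℝ) • (c ^ 2 * der (der (der q)))
          + (11 / 2 : ℝ) • (p * der (der q)) + (7 / 2 : ℝ) • (der p * der q)) * jet 1))
    + sandwich (sandwich (skewOp (fn ((1 / 384 : ℝ) • (c * der c * der q)
          + (1 / 128 : ℝ) • (c ^ 2 * der (der q)) + (5 / 2 : ℝ) • (p * der q)))))

/-- The obstruction to solving the recursion relation at order `ε⁴`. -/
def obstruction (c p q : Smooth I) : Smooth I :=
  (1 / 2 : ℝ) • (p * der q) - (1 / 384 : ℝ) • (c * der c * der q)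
    + (1 / 1920 : ℝ) • (c * c * der (der q))

/-- The defect of the recursion relation at order `ε⁴`, with `w` the obstruction. -/
def defect (w g : Smooth I) : DiffPoly I :=
  fn (der g) * (fn w * jet 4 + (2 : ℝ) • (fn (der w) * jet 0 * jet 3)
      + fn (der (der w)) * (jet 0 ^ 2 * jet 2 - (1 / 2 : ℝ) • (jet 0 * jet 1 ^ 2)))
    + fn (der (der g)) * ((3 : ℝ) • (fn w * jet 0 * jet 3)
      + (3 : ℝ) • (fn (der w) * (jet 0 ^ 2 * jet 2 - (1 / 2 : ℝ) • (jet 0 * jet 1 ^ 2))))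
    + fn (der (der (der g))) *
      ((2 : ℝ) • (fn w * (jet 0 ^ 2 * jet 2 - (1 / 2 : ℝ) • (jet 0 * jet 1 ^ 2))))

section Recursion

variable {c p s q g k : Smooth I}

theorem recursion_zero (hk : der k = q * der g + (1 / 2 : ℝ) • (der q * g)) :
    dx (fn k) = (skewOp (fn q)).act (fn g) := by
  rw [dx_fn, hk]
  refine ext_evalJet fun u x => ?_
  simp only [skewOp_act, dx_fn, map_add, map_mul, evalJet_fn, evalJet_jet, evalJet_smul,
    Smooth.add_apply, Smooth.mul_apply, Smooth.smul_apply]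
  ring

theorem recursion_two (hk : der k = q * der g + (1 / 2 : ℝ) • (der q * g)) :
    dx (gradTwo (hamA c (der (der k)))) =
      (skewOp (fn q)).act (gradTwo (hamA c (der (der g)))) + (opTwo c q).act (fn g) := by
  rw [hk]
  refine ext_evalJet fun u x => ?_
  simp only [opTwo, gradTwo, hamA, act_add_left, skewOp_act, sandwich_act, pow_two, dx_mul, dx_smul,
    dx_fn, dx_jet, map_add, map_mul, evalJet_fn, evalJet_jet, evalJet_smul, Smooth.der_add,
    Smooth.der_mul, Smooth.der_smul, Smooth.add_apply, Smooth.mul_apply, Smooth.smul_apply]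
  ring

set_option maxRecDepth 1000 in
theorem recursion_four (hk : der k = q * der g + (1 / 2 : ℝ) • (der q * g)) :
    dx (gradFour (hamP c p (der (der k))) (hamR c p s (der (der k)))) =
      (skewOp (fn q)).act (gradFour (hamP c p (der (der g))) (hamR c p s (der (der g))))
        + (opTwo c q).act (gradTwo (hamA c (der (der g)))) + (opFour c p s q).act (fn g)
        + defect (obstruction c p q) g := by
  rw [hk]
  refine ext_evalJet fun u x => ?_
  simp only [opTwo, opFour, obstruction, defect, gradTwo, gradFour, hamA, hamP, hamR, act_add_left,
    skewOp_act, sandwich_act, pow_succ, pow_zero, one_mul, dx_mul, dx_smul, dx_fn, dx_jet, map_add,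
    map_mul, map_sub, evalJet_fn, evalJet_jet, evalJet_smul, Smooth.der_add, Smooth.der_sub,
    Smooth.der_mul, Smooth.der_smul, Smooth.add_apply, Smooth.mul_apply, Smooth.sub_apply,
    Smooth.smul_apply]
  ring

end Recursion

/-- The second bracket of the bihamiltonian structure with leading term given by `q`. -/
def opSeries (c p s q : Smooth I) : Ser (DiffOp I) :=
  ![skewOp (fn q), 0, opTwo c q, 0, opFour c p s q, 0]

theorem isSkew_opSeries (c p s q : Smooth I) (n : Fin 6) : IsSkew (opSeries c p s q n) := by
  have zero : IsSkew (0 : DiffOp I) := fun a b => by simp [act_zero_left]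
  fin_cases n
  exacts [isSkew_skewOp _, zero, (isSkew_skewOp _).add (isSkew_skewOp _).sandwich, zero,
    ((isSkew_skewOp _).add (isSkew_skewOp _).sandwich).add (isSkew_skewOp _).sandwich.sandwich,
    zero]

theorem opHasDegree_opTwo (c q : Smooth I) : OpHasDegree (opTwo c q) 3 :=
  (opHasDegree_skewOp (hasDegree_gradTwo _)).add (opHasDegree_skewOp (hasDegree_fn _)).sandwich

theorem opHasDegree_opFour (c p s q : Smooth I) : OpHasDegree (opFour c p s q) 5 :=
  ((opHasDegree_skewOp (hasDegree_gradFour _ _)).add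
    (opHasDegree_skewOp ((HasDegree.fn_mul ((hasDegree_jet 0).pow 2) _).add
      (HasDegree.fn_mul (hasDegree_jet 1) _))).sandwich).add
    (opHasDegree_skewOp (hasDegree_fn _)).sandwich.sandwich

theorem opHasDegree_opSeries (c p s q : Smooth I) (n : Fin 6) :
    OpHasDegree (opSeries c p s q n) (n + 1) := by
  fin_cases n
  exacts [opHasDegree_skewOp (hasDegree_fn q), .zero, opHasDegree_opTwo c q, .zero,
    opHasDegree_opFour c p s q, .zero]

theorem firstOp_apply_zero : firstOp I 0 = skewOp (fn 1) := by
  rw [← secondOp_eq_skewOp, secondOp]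
  simp [firstOp, fn]

theorem isDeformation_opSeries (c p s q : Smooth I) :
    IsDeformation (secondOp q) (opSeries c p s q) where
  leading := (secondOp_eq_skewOp q).symm
  graded := opHasDegree_opSeries c p s q

theorem field_firstOp (G : Ser (DiffPoly I)) (n : Fin 6) :
    field (firstOp I) G n = dx (varD (G n)) := by
  rw [field, Ser.conv, Finset.sum_eq_single_of_mem 0 (Finset.mem_univ _),
    Finset.sum_eq_single_of_mem n (Finset.mem_univ _)]
  · simp [firstOp, act_single]
  · intro j _ hj
    exact if_neg (by simpa [Fin.ext_iff] using hj)
  · intro i _ hi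
    simp [firstOp, hi, act_zero_left]

theorem field_ham (L : Ser (DiffOp I)) (c p s f : Smooth I) :
    field L (ham c p s f) = Ser.conv DiffOp.act L (hamGrad c p s (der f)) :=
  congrArg (Ser.conv DiffOp.act L) (funext (varD_ham c p s f))

theorem field_firstOp_ham {c p s q f g : Smooth I}
    (h : der (der f) = q * der (der g) + (1 / 2 : ℝ) • (der q * der g)) (n : Fin 6) :
    field (firstOp I) (ham c p s f) n = field (opSeries c p s q) (ham c p s g) n
      + if n = 4 then defect (obstruction c p q) (der g) else 0 := by
  rw [field_firstOp, varD_ham, field_ham]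
  have h₀ := recursion_zero h
  have h₂ := recursion_two (c := c) h
  have h₄ := recursion_four (c := c) (p := p) (s := s) h
  fin_cases n <;>
    simp [Ser.conv, Fin.sum_univ_six, hamGrad, opSeries, act_zero_left, act_zero, h₀, h₂, h₄]

section Affine

variable (c p s : Smooth I) {q r : Smooth I} {a : ℝ}

theorem opTwo_eq_smul (h : der r = a • der q) : opTwo c r = a • opTwo c q := by
  simp only [opTwo, gradTwo, hamA, h, Smooth.der_smul, mul_smul_comm, fn_smul, smul_mul_assoc,
    map_add, map_smul]
  module

theorem opFour_eq_smul (h : der r = a • der q) : opFour c p s r = a • opFour c p s q := by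
  simp only [opFour, gradFour, hamP, hamR, h, Smooth.der_add, Smooth.der_sub, Smooth.der_mul,
    Smooth.der_smul, mul_smul_comm, smul_mul_assoc, fn_add, fn_sub, fn_smul, add_mul, sub_mul,
    map_add, map_sub, map_smul]
  module

theorem opSeries_affine (q : Smooth I) (a b : ℝ) :
    opSeries c p s (a • q + algebraMap ℝ _ b) = a • opSeries c p s q + b • firstOp I := by
  have h : der (a • q + algebraMap ℝ _ b) = a • der q := by
    rw [Smooth.der_add, Smooth.der_smul, Smooth.der_algebraMap, add_zero]
  funext n
  fin_cases n
  · change skewOp (fn (a • q + algebraMap ℝ _ b)) = a • skewOp (fn q) + b • firstOp I 0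
    rw [firstOp_apply_zero, fn_add, fn_smul, Algebra.algebraMap_eq_smul_one, fn_smul, map_add,
      map_smul, map_smul]
  · simp [opSeries, firstOp]
  · simpa [opSeries, firstOp] using opTwo_eq_smul c h
  · simp [opSeries, firstOp]
  · simpa [opSeries, firstOp] using opFour_eq_smul c p s h
  · simp [opSeries, firstOp]

end Affine

section FirstBracket

theorem loc_gradTwo_mul_dx_fn (a f : Smooth I) :
    loc (gradTwo a * dx (fn f)) = loc (-fn (a * der (der f)) * jet 0 ^ 3) := by
  have hdx : gradTwo a * dx (fn f) =
      -fn (a * der (der f)) * jet 0 ^ 3 + dx (fn (a * der f) * jet 0 ^ 2) := by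
    refine ext_evalJet fun u x => ?_
    simp only [gradTwo, pow_succ, pow_zero, one_mul, dx_mul, dx_fn, dx_jet, map_add, map_mul,
      map_neg, evalJet_fn, evalJet_jet, evalJet_smul, Smooth.der_mul, Smooth.add_apply,
      Smooth.mul_apply]
    ring
  rw [hdx, map_add, loc_dx, add_zero]

theorem loc_gradTwo_mul_dx_gradTwo (a b : Smooth I) :
    loc (gradTwo a * dx (gradTwo b)) =
      loc ((6 : ℝ) • (fn (a * der b - der a * b) * (jet 0 * jet 1 ^ 2))
        - (1 / 2 : ℝ) • (fn (a * der (der (der b)) - der (der (der a)) * b) * jet 0 ^ 5)) := by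
  have hdx : gradTwo a * dx (gradTwo b) =
      (6 : ℝ) • (fn (a * der b - der a * b) * (jet 0 * jet 1 ^ 2))
        - (1 / 2 : ℝ) • (fn (a * der (der (der b)) - der (der (der a)) * b) * jet 0 ^ 5)
        + dx ((2 : ℝ) • (fn (a * b) * jet 1 ^ 2) + (2 : ℝ) • (fn (der a * b) * (jet 0 ^ 2 * jet 1))
          + (1 / 2 : ℝ) •
            (fn (der a * der b + a * der (der b) - der (der a) * b) * jet 0 ^ 4)) := by
    refine ext_evalJet fun u x => ?_
    simp only [gradTwo, pow_succ, pow_zero, one_mul, dx_mul, dx_smul, dx_fn, dx_jet, map_add,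
      map_sub, map_mul, evalJet_fn, evalJet_jet, evalJet_smul, Smooth.der_add, Smooth.der_sub,
      Smooth.der_mul, Smooth.add_apply, Smooth.sub_apply, Smooth.mul_apply]
    ring
  rw [hdx, map_add, loc_dx, add_zero]

theorem loc_gradFour_mul_dx_fn (P R f : Smooth I) :
    loc (gradFour P R * dx (fn f)) =
      loc ((5 : ℝ) • (fn (P * der (der f)) * (jet 0 * jet 1 ^ 2))
        - fn ((1 / 2 : ℝ) • der (P * der (der (der f))) + (3 : ℝ) • (R * der (der f)))
          * jet 0 ^ 5) := by
  have hdx : gradFour P R * dx (fn f) =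
      (5 : ℝ) • (fn (P * der (der f)) * (jet 0 * jet 1 ^ 2))
        - fn ((1 / 2 : ℝ) • der (P * der (der (der f))) + (3 : ℝ) • (R * der (der f))) * jet 0 ^ 5
        + dx ((2 : ℝ) • (fn (P * der f) * (jet 0 * jet 2)) - fn (P * der f) * jet 1 ^ 2
          + (2 : ℝ) • (fn (der P * der f - P * der (der f)) * (jet 0 ^ 2 * jet 1))
          + fn ((1 / 2 : ℝ) • (P * der (der (der f))) + (3 : ℝ) • (R * der f)) * jet 0 ^ 4) := by
    refine ext_evalJet fun u x => ?_
    simp only [gradFour, pow_succ, pow_zero, one_mul, dx_mul, dx_smul, dx_fn, dx_jet, map_add,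
      map_sub, map_mul, evalJet_fn, evalJet_jet, evalJet_smul, Smooth.der_add, Smooth.der_sub,
      Smooth.der_smul, Smooth.der_mul, Smooth.add_apply, Smooth.sub_apply, Smooth.mul_apply,
      Smooth.smul_apply]
    ring
  rw [hdx, map_add, loc_dx, add_zero]

variable (c p s f g : Smooth I)

theorem loc_bracket_firstOp_ham_two :
    loc (fn f * dx (gradTwo (hamA c (der (der g))))) +
      loc (gradTwo (hamA c (der (der f))) * dx (fn g)) = 0 := by
  rw [loc_mul_dx, mul_comm, loc_gradTwo_mul_dx_fn, loc_gradTwo_mul_dx_fn, hamA, hamA,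
    smul_mul_assoc, smul_mul_assoc, mul_right_comm, neg_add_cancel]

theorem loc_bracket_firstOp_ham_four :
    loc (fn f * dx (gradFour (hamP c p (der (der g))) (hamR c p s (der (der g)))))
      + loc (gradTwo (hamA c (der (der f))) * dx (gradTwo (hamA c (der (der g)))))
      + loc (gradFour (hamP c p (der (der f))) (hamR c p s (der (der f))) * dx (fn g)) = 0 := by
  rw [loc_mul_dx, mul_comm (dx (fn f)), loc_gradFour_mul_dx_fn, loc_gradFour_mul_dx_fn,
    loc_gradTwo_mul_dx_gradTwo, ← map_neg, ← map_add, ← map_add, ← map_zero loc]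
  refine congrArg loc (ext_evalJet fun u x => ?_)
  simp only [hamA, hamP, hamR, pow_two, map_add, map_sub, map_neg, map_zero, map_mul, map_pow,
    evalJet_fn, evalJet_jet, evalJet_smul, Smooth.der_add, Smooth.der_mul, Smooth.der_smul,
    Smooth.add_apply, Smooth.sub_apply, Smooth.mul_apply, Smooth.smul_apply]
  ring

theorem loc_fn_mul_dx_fn (hI : IsConnected (I : Set ℝ)) : loc (fn f * dx (fn g)) = 0 := by
  obtain ⟨h, hh⟩ := Smooth.exists_der_eq hI (f * der g)
  rw [dx_fn, ← mul_assoc, fn, fn, ← map_mul, ← hh]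
  exact (congrArg loc (dx_fn h)).symm.trans (loc_dx _)

theorem isNull_bracket_firstOp_ham (hI : IsConnected (I : Set ℝ)) :
    IsNull (bracket (firstOp I) (ham c p s f) (ham c p s g)) := by
  refine isNull_iff_loc.2 fun n => ?_
  have hbracket : bracket (firstOp I) (ham c p s f) (ham c p s g) =
      Ser.conv (· * ·) (hamGrad c p s (der f)) fun n => dx (hamGrad c p s (der g) n) :=
    congrArg₂ (Ser.conv (· * ·)) (funext (varD_ham c p s f))
      (funext fun n => (field_firstOp _ n).trans (congrArg dx (varD_ham c p s g n)))
  rw [hbracket]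
  fin_cases n
  · simpa [Ser.conv, Fin.sum_univ_six, hamGrad] using loc_fn_mul_dx_fn (der f) (der g) hI
  · simp [Ser.conv, Fin.sum_univ_six, hamGrad]
  · simpa [Ser.conv, Fin.sum_univ_six, hamGrad] using loc_bracket_firstOp_ham_two c (der f) (der g)
  · simp [Ser.conv, Fin.sum_univ_six, hamGrad]
  · simpa [Ser.conv, Fin.sum_univ_six, hamGrad] using
      loc_bracket_firstOp_ham_four c p s (der f) (der g)
  · simp [Ser.conv, Fin.sum_univ_six, hamGrad]

end FirstBracket

/-! ### The obstruction -/

section Obstruction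

theorem defect_zero (g : Smooth I) : defect 0 g = 0 :=
  ext_evalJet fun u x => by simp [defect]

theorem dx_pow_succ_divPow_one (u : I) (j : ℕ) :
    (dx ^ (j + 1)) (fn (Smooth.divPow u 1)) = (jet j : DiffPoly I) := by
  induction j with
  | zero =>
    have hone : (Smooth.divPow u 0 : Smooth I) = 1 := Smooth.ext fun v => by simp [Smooth.divPow]
    rw [zero_add, pow_one, dx_fn, Smooth.der_divPow_succ, hone, fn, map_one, one_mul]
  | succ j ih => rw [dx_pow_succ, ih, dx_jet]

theorem eq_zero_of_act_eq_defect {B : DiffOp I} {w : Smooth I} (hB : OpHasDegree B 5)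
    (h : ∀ g, B.act (fn g) = defect w g) : w = 0 := by
  have top : B 5 = 0 := ext_atPoint fun u => by
    have hdefect : atPoint u (defect w (Smooth.divPow u 5)) = 0 := by
      simp only [defect, Smooth.der_divPow_succ, map_add, map_mul, atPoint_fn,
        Smooth.divPow_apply_succ, map_zero, zero_mul, add_zero]
    have hact := atPoint_act_divPow u (k := 5) fun j => hB.eq_zero_of_lt
    rw [h, hdefect, eq_comm, mul_eq_zero] at hact
    rw [map_zero]
    exact hact.resolve_right (pow_ne_zero _ (MvPolynomial.X_ne_zero 0))
  refine Smooth.ext fun u => ?_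
  -- `u⁽⁵⁾` occurs in the defect, but `B` no longer differentiates often enough to produce it.
  have hdefect : evalJet u (Pi.single 4 1) (defect w (Smooth.divPow u 1)) = w u := by
    simp [defect, Smooth.der_divPow_succ, Smooth.divPow_apply_zero]
  rw [← hdefect, ← h, act_eq_sum, map_sum, Smooth.zero_apply]
  refine Finset.sum_eq_zero fun j hj => ?_
  have hlt : j < 5 := by
    by_contra! hle
    exact Finsupp.mem_support_iff.1 hj
      (hle.eq_or_lt.elim (fun heq => heq ▸ top) fun hlt => hB.eq_zero_of_lt hlt)
  rw [map_mul, mul_eq_zero]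
  right
  rcases j with _ | j
  · rw [pow_zero, Module.End.one_apply, evalJet_fn, Smooth.divPow_apply_succ]
  · rw [dx_pow_succ_divPow_one, evalJet_jet, Pi.single_eq_of_ne (by omega)]

theorem obstruction_eq_zero_iff {c p q : Smooth I} (hc : ∀ u, c u ≠ 0) (hq : ∀ u, der q u ≠ 0) :
    obstruction c p q = 0 ↔
      ∀ u, p u = c u ^ 2 / 960 * (5 * (der c u / c u) - der (der q) u / der q u) := by
  have formula (u : I) : c u ^ 2 / 960 * (5 * (der c u / c u) - der (der q) u / der q u) =
      p u - 2 * obstruction c p q u / der q u := by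
    have hcu := hc u
    have hqu := hq u
    simp only [obstruction, Smooth.add_apply, Smooth.sub_apply, Smooth.mul_apply,
      Smooth.smul_apply]
    field_simp
    ring
  have pointwise (u : I) : p u = p u - 2 * obstruction c p q u / der q u ↔
      obstruction c p q u = 0 := by
    rw [eq_comm, sub_eq_self, div_eq_zero_iff, or_iff_left (hq u), mul_eq_zero,
      or_iff_right two_ne_zero]
  simp only [formula, pointwise]
  exact ⟨fun h u => by rw [h, Smooth.zero_apply], fun h => Smooth.ext h⟩

theorem exists_obstruction_eq_zero (hI : IsConnected (I : Set ℝ)) {c : Smooth I} (p : Smooth I)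
    (hc : ∀ u, c u ≠ 0) : ∃ q : Smooth I, (∀ u, der q u ≠ 0) ∧ obstruction c p q = 0 := by
  obtain ⟨d, hd⟩ := Smooth.exists_mul_eq_one hc
  obtain ⟨k, hk⟩ := Smooth.exists_der_eq hI ((5 : ℝ) • (der c * d) - (960 : ℝ) • (p * d ^ 2))
  obtain ⟨e, he, hde⟩ := Smooth.exists_exp k
  obtain ⟨q, rfl⟩ := Smooth.exists_der_eq hI e
  refine ⟨q, he, Smooth.ext fun u => ?_⟩
  have hcd : c u * d u = 1 := by rw [← Smooth.mul_apply, hd, Smooth.one_apply]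
  rw [obstruction, hde, hk]
  simp only [Smooth.add_apply, Smooth.sub_apply, Smooth.mul_apply, Smooth.smul_apply,
    Smooth.pow_apply, Smooth.zero_apply]
  linear_combination ((1 / 384 : ℝ) * c u * der c u * der q u
    - (1 / 2 : ℝ) * p u * der q u * (c u * d u + 1)) * hcd

theorem der_der_mul_der_of_obstruction_eq_zero {c p q r : Smooth I} (hc : ∀ u, c u ≠ 0)
    (hwq : obstruction c p q = 0) (hwr : obstruction c p r = 0) :
    der (der r) * der q = der r * der (der q) := by
  refine Smooth.ext fun u => ?_
  have hq := congrArg (Smooth.evalHom u) hwq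
  have hr := congrArg (Smooth.evalHom u) hwr
  simp only [obstruction, Smooth.evalHom_apply, Smooth.add_apply, Smooth.sub_apply,
    Smooth.mul_apply, Smooth.smul_apply, Smooth.zero_apply] at hq hr
  refine mul_left_cancel₀ (pow_ne_zero 2 (hc u)) ?_
  simp only [Smooth.mul_apply]
  linear_combination 1920 * der q u * hr - 1920 * der r u * hq

theorem Smooth.exists_eq_smul_of_der_mul_eq (hI : IsConnected (I : Set ℝ)) {f g : Smooth I}
    (hg : ∀ u, g u ≠ 0) (h : der f * g = f * der g) : ∃ a : ℝ, f = a • g := by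
  obtain ⟨d, hd⟩ := Smooth.exists_mul_eq_one hg
  have hder := congrArg der hd
  rw [Smooth.der_mul, Smooth.der_one] at hder
  obtain ⟨a, ha⟩ := Smooth.exists_eq_of_der_eq_zero hI (f := f * d) (by
    rw [Smooth.der_mul]
    linear_combination d ^ 2 * h + d * f * hder - (der f * d + f * der d) * hd)
  refine ⟨a, ?_⟩
  rw [Algebra.smul_def, ← ha]
  linear_combination -f * hd

theorem exists_affine_of_obstruction_eq_zero (hI : IsConnected (I : Set ℝ)) {c p q r : Smooth I}
    (hc : ∀ u, c u ≠ 0) (hq : ∀ u, der q u ≠ 0) (hr : ∀ u, der r u ≠ 0)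
    (hwq : obstruction c p q = 0) (hwr : obstruction c p r = 0) :
    ∃ a b : ℝ, a ≠ 0 ∧ r = a • q + algebraMap ℝ _ b := by
  obtain ⟨a, ha⟩ := Smooth.exists_eq_smul_of_der_mul_eq hI hq
    (der_der_mul_der_of_obstruction_eq_zero hc hwq hwr)
  obtain ⟨b, hb⟩ := Smooth.exists_eq_of_der_eq_zero hI (f := r - a • q) (by
    rw [Smooth.der_sub, Smooth.der_smul, ha, sub_self])
  refine ⟨a, b, ?_, sub_eq_iff_eq_add'.1 hb⟩
  rintro rfl
  obtain ⟨u, hu⟩ := hI.nonempty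
  exact hr ⟨u, hu⟩ (by rw [ha, Smooth.smul_apply, zero_mul])

end Obstruction

section Existence

theorem exists_der_der_eq (hI : IsConnected (I : Set ℝ)) (q g : Smooth I) :
    ∃ f : Smooth I, der (der f) = q * der (der g) + (1 / 2 : ℝ) • (der q * der g) := by
  obtain ⟨k, hk⟩ := Smooth.exists_der_eq hI (q * der (der g) + (1 / 2 : ℝ) • (der q * der g))
  obtain ⟨f, rfl⟩ := Smooth.exists_der_eq hI k
  exact ⟨f, hk⟩

theorem obstruction_add_algebraMap (c p q : Smooth I) (b : ℝ) :
    obstruction c p (q + algebraMap ℝ _ b) = obstruction c p q := by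
  rw [obstruction, Smooth.der_add, Smooth.der_algebraMap, add_zero, obstruction]

variable {c p q : Smooth I} (s : Smooth I)

theorem field_firstOp_ham_of_obstruction_eq_zero (hw : obstruction c p q = 0) {f g : Smooth I}
    (h : der (der f) = q * der (der g) + (1 / 2 : ℝ) • (der q * der g)) :
    field (firstOp I) (ham c p s f) = field (opSeries c p s q) (ham c p s g) := by
  funext n
  rw [field_firstOp_ham h, hw, defect_zero, ite_self, add_zero]

theorem isNull_bracket_opSeries_ham (hI : IsConnected (I : Set ℝ)) (hw : obstruction c p q = 0)
    (f g : Smooth I) : IsNull (bracket (opSeries c p s q) (ham c p s f) (ham c p s g)) := by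
  obtain ⟨k, hk⟩ := exists_der_der_eq hI q g
  rw [bracket, ← field_firstOp_ham_of_obstruction_eq_zero s hw hk]
  exact isNull_bracket_firstOp_ham c p s f k hI

theorem isPoisson_opSeries (hI : IsConnected (I : Set ℝ)) (hw : obstruction c p q = 0) :
    IsPoisson (opSeries c p s q) :=
  isPoisson_of_commute hI (isSkew_opSeries c p s q) (opHasDegree_opSeries c p s q)
    (fun _ => rfl) (isNull_bracket_opSeries_ham s hI hw)

theorem isPoisson_firstOp (hI : IsConnected (I : Set ℝ)) : IsPoisson (firstOp I) := by
  have hfirst := opSeries_affine (0 : Smooth I) 0 0 0 0 1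
  rw [zero_smul, zero_add, zero_smul, zero_add, one_smul] at hfirst
  rw [← hfirst]
  exact isPoisson_opSeries 0 hI (by simp [obstruction])

theorem isBihamiltonian_opSeries (hI : IsConnected (I : Set ℝ)) (hw : obstruction c p q = 0) :
    IsBihamiltonian c p s q (opSeries c p s q) where
  deformation := isDeformation_opSeries c p s q
  first := isPoisson_firstOp hI
  pencil l := by
    have hpencil := opSeries_affine c p s q 1 (-l)
    rw [one_smul, one_smul] at hpencil
    have hsub : opSeries c p s q - l • firstOp I = opSeries c p s q + -l • firstOp I := by module
    rw [hsub, ← hpencil]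
    exact isPoisson_opSeries s hI ((obstruction_add_algebraMap c p q (-l)).trans hw)
  commute_first f g := isNull_bracket_firstOp_ham c p s f g hI
  commute_second := isNull_bracket_opSeries_ham s hI hw

end Existence

namespace IsBihamiltonian

variable {c p s q : Smooth I} {L : Ser (DiffOp I)}

theorem field_eq (hI : IsConnected (I : Set ℝ)) (hL : IsBihamiltonian c p s q L) {f g : Smooth I}
    (h : der (der f) = q * der (der g) + (1 / 2 : ℝ) • (der q * der g)) :
    field (firstOp I) (ham c p s f) = field L (ham c p s g) := by
  have hfirst (n : Fin 6) : OpHasDegree (firstOp I n) (n + 1) := by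
    rw [firstOp]
    split_ifs with hn
    · rw [hn]
      exact .single rfl (MvPolynomial.isWeightedHomogeneous_one _ _)
    · exact .zero
  refine field_eq_of_commute hI hfirst hL.deformation.graded (fun _ => rfl)
    (varD_ham_mem_degGE c p s f) (varD_ham_mem_degGE c p s g) (fun k => hL.commute_first k f)
    (fun k => hL.commute_second k g) ?_
  rw [field_firstOp, varD_ham, field_apply_zero, varD_ham, hL.deformation.leading,
    secondOp_eq_skewOp]
  exact recursion_zero h

theorem field_eq_add_defect (hI : IsConnected (I : Set ℝ)) (hL : IsBihamiltonian c p s q L)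
    (g : Smooth I) (n : Fin 6) :
    field L (ham c p s g) n = field (opSeries c p s q) (ham c p s g) n
      + if n = 4 then defect (obstruction c p q) (der g) else 0 := by
  obtain ⟨f, hf⟩ := exists_der_der_eq hI q g
  rw [← hL.field_eq hI hf, field_firstOp_ham hf]

theorem obstruction_eq_zero (hI : IsConnected (I : Set ℝ)) (hL : IsBihamiltonian c p s q L) :
    obstruction c p q = 0 := by
  have below : ∀ k < 4, L k = opSeries c p s q k := fun k hk =>
    apply_eq_of_field_eq (H := ham c p s) hI (fun _ => rfl) fun j hj g => by
      rw [hL.field_eq_add_defect hI, if_neg (hj.trans_lt hk).ne, add_zero]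
  refine eq_zero_of_act_eq_defect
    (OpHasDegree.sub (hL.deformation.graded 4) (opHasDegree_opFour c p s q)) fun g' => ?_
  obtain ⟨g, rfl⟩ := Smooth.exists_der_eq hI g'
  have hsub := field_sub_field_of_eq below (ham c p s g)
  rw [hL.field_eq_add_defect hI, if_pos rfl, add_sub_cancel_left, varD_ham] at hsub
  exact hsub.symm

theorem eq_opSeries (hI : IsConnected (I : Set ℝ)) (hL : IsBihamiltonian c p s q L) :
    L = opSeries c p s q :=
  funext fun _ => apply_eq_of_field_eq (H := ham c p s) hI (fun _ => rfl) fun k _ g => by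
    rw [hL.field_eq_add_defect hI, hL.obstruction_eq_zero hI, defect_zero, ite_self, add_zero]

end IsBihamiltonian

theorem isBihamiltonian_iff (hI : IsConnected (I : Set ℝ)) {c p s q : Smooth I}
    {L : Ser (DiffOp I)} :
    IsBihamiltonian c p s q L ↔ obstruction c p q = 0 ∧ L = opSeries c p s q := by
  refine ⟨fun hL => ⟨hL.obstruction_eq_zero hI, hL.eq_opSeries hI⟩, ?_⟩
  rintro ⟨hw, rfl⟩
  exact isBihamiltonian_opSeries s hI hw

end

end BiHam

open BiHam in
theorem mainTheorem5 (I : TopologicalSpace.Opens ℝ) (hI : IsConnected (I : Set ℝ))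
    (c p s : Smooth I) (hc : ∀ u, c u ≠ 0) :
    -- for a given `q`: existence criterion and uniqueness
    (∀ q : Smooth I, (∀ u, der q u ≠ 0) →
      ((∃ L, IsBihamiltonian c p s q L) ↔
        ∀ u, p u = c u ^ 2 / 960 * (5 * (der c u / c u) - der (der q) u / der q u)) ∧
      ((∀ u, p u = c u ^ 2 / 960 * (5 * (der c u / c u) - der (der q) u / der q u)) →
        ∃! L, IsBihamiltonian c p s q L)) ∧
    -- for given Hamiltonians there is such a `q`, and the resulting pencil is unique
    (∃ q : Smooth I, (∀ u, der q u ≠ 0) ∧ ∃ L, IsBihamiltonian c p s q L) ∧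
    (∀ q r : Smooth I, (∀ u, der q u ≠ 0) → (∀ u, der r u ≠ 0) →
      ∀ L M, IsBihamiltonian c p s q L → IsBihamiltonian c p s r M →
        ∃ a b : ℝ, a ≠ 0 ∧ (∀ u, r u = a * q u + b) ∧ M = a • L + b • firstOp I) ∧
    -- the flows are Hamiltonian with respect to both brackets
    (∀ q : Smooth I, (∀ u, der q u ≠ 0) → ∀ L, IsBihamiltonian c p s q L →
      ∀ f g : Smooth I,
        (∀ u, der (der f) u = q u * der (der g) u + 1 / 2 * der q u * der g u) →
        field (firstOp I) (ham c p s f) = field L (ham c p s g)) := by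
  refine ⟨fun q hq => ?_, ?_, fun q r hq hr L M hL hM => ?_, fun q _ L hL f g h => ?_⟩
  · simp only [isBihamiltonian_iff hI, ← obstruction_eq_zero_iff hc hq]
    exact ⟨⟨fun ⟨_, hw, _⟩ => hw, fun hw => ⟨_, hw, rfl⟩⟩,
      fun hw => ⟨_, ⟨hw, rfl⟩, fun _ hL => hL.2⟩⟩
  · obtain ⟨q, hq, hw⟩ := exists_obstruction_eq_zero hI p hc
    exact ⟨q, hq, _, isBihamiltonian_opSeries s hI hw⟩
  · obtain ⟨hwq, rfl⟩ := (isBihamiltonian_iff hI).1 hL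
    obtain ⟨hwr, rfl⟩ := (isBihamiltonian_iff hI).1 hM
    obtain ⟨a, b, ha, rfl⟩ := exists_affine_of_obstruction_eq_zero hI hc hq hr hwq hwr
    exact ⟨a, b, ha, fun _ => rfl, opSeries_affine c p s q a b⟩
  · refine hL.field_eq hI (Smooth.ext fun u => ?_)
    rw [h, mul_assoc]
    rfl
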